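/- Let $T>0$, $0<k<1$, $\tilde\sigma>0$, $\alpha_k(t)=1+kt$, $\Omega_t=(0,\alpha_k(t))$, and $\widehat Q=\{(x,t):0<t<T,\ 0<x<\alpha_k(t)\}$ with lateral boundary $\widehat\Sigma=\widehat\Sigma_0\cup\widehat\Sigma_0^*$, where $\widehat\Sigma_0=\{0\}\times(0,T)$ and $\widehat\Sigma_0^*=\{(\alpha_k(t),t):0<t<T\}$. Let $\widehat\Sigma_0=\widehat\Sigma_1\cup\widehat\Sigma_2$ with $\widehat\Sigma_1,\widehat\Sigma_2$ measurable (for example disjoint, or both equal to $\widehat\Sigma_0$), and let $\tilde u_2\in L^2(\widehat Q)$. Functions on $\widehat\Sigma_i$ are extended by $0$ to $\widehat\Sigma_0$. For $f\in L^2(\widehat Q)$ let $\theta=\theta^f\in H^1(\widehat Q)$ denote the weak solution of $\theta''-\theta_{xx}=f$ in $\widehat Q$, $\theta=0$ on $\widehat\Sigma$, $\theta(T)=\theta'(T)=0$; it has a trace $\theta_x(0,\cdot)\in L^2(0,T)$. For $w\in L^2(0,T)$, a function $u\in L^2(\widehat Q)$ is the solution by transposition of $$u''-u_{xx}=0\ \text{in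 }\widehat Q,\quad u=w\ \text{on }\widehat\Sigma_0,\quad u=0\ \text{on }\widehat\Sigma_0^*,\quad u(0)=u'(0)=0\qquad(*)$$ if $\iint_{\widehat Q}uf\,dx\,dt=\int_0^T w(t)\,\theta^f_x(0,t)\,dt$ for all $f\in L^2(\widehat Q)$. Fix $\tilde w_1\in L^2(\widehat\Sigma_1)$. Then: 1. For every $\tilde w_2\in L^2(\widehat\Sigma_2)$ problem $(*)$ with $w=\tilde w_1+\tilde w_2$ has exactly one solution by transposition $u(\tilde w_1,\tilde w_2)$, so that the follower's cost $$\tilde J_2(\tilde w_1,\tilde w_2)=\frac12\iint_{\widehat Q}\bigl(u(\tilde w_1,\tilde w_2)-\tilde u_2\bigr)^2dx\,dt+\frac{\tilde\sigma}2\int_{\widehat\Sigma_2}\tilde w_2^2\,d\widehat\Sigma$$ is well defined. 2. There is a unique Nash equilibrium, that is, a unique $\tilde w_2\in L^2(\widehat\Sigma_2)$ with $\tilde J_2(\tilde w_1,\tilde w_2)=\inf_{\hat w_2\in L^2(\widehat\Sigma_2)}\tilde J_2(\tilde w_1,\hat w_2)$. 3. The optimality system $$\begin{cases}u''-u_{xx}=0,\quad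 p''-p_{xx}=u-\tilde u_2&\text{in }\widehat Q,\\ u=\tilde w_1+\bigl(-\tfrac1{\tilde\sigma}\,p_x\bigr)\mathbf 1_{\widehat\Sigma_2}&\text{on }\widehat\Sigma_0,\\ u=0&\text{on }\widehat\Sigma_0^*,\\ p=0&\text{on }\widehat\Sigma,\\ u(0)=u'(0)=0,\quad p(T)=p'(T)=0,\end{cases}$$ in which $u\in L^2(\widehat Q)$ is a solution by transposition and $p\in H^1(\widehat Q)$ a weak solution with $p_x(0,\cdot)\in L^2(0,T)$, has a unique solution $\{u,p\}$, and the Nash equilibrium is $$\tilde w_2=\frac1{\tilde\sigma}\,\frac{\partial p}{\partial\nu}=-\frac1{\tilde\sigma}\,p_x\quad\text{on }\widehat\Sigma_2,$$ where $\nu=-1$ is the outward normal at $x=0$. -/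

import Mathlib

open MeasureTheory Set
open scoped ContDiff

noncomputable section

namespace MovingWave

/-- The non-cylindrical domain: points `z = (x, t)` with `0 < t < T` and `0 < x < 1 + k t`. -/
def domain (k T : ℝ) : Set (ℝ × ℝ) :=
  {z | 0 < z.2 ∧ z.2 < T ∧ 0 < z.1 ∧ z.1 < 1 + k * z.2}

/-- Square integrable functions on the moving domain. -/
abbrev L2Domain (k T : ℝ) : Type := Lp ℝ 2 (volume.restrict (domain k T))

/-- Square integrable functions of time on a part `{0} × S` of the fixed lateral boundary,
whose surface measure is `dt`. -/
abbrev L2Time (S : Set ℝ) : Type := Lp ℝ 2 (volume.restrict S)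

/-- `∂φ/∂x` -/
def dx (φ : ℝ × ℝ → ℝ) (z : ℝ × ℝ) : ℝ := fderiv ℝ φ z (1, 0)

/-- `∂φ/∂t` -/
def dt (φ : ℝ × ℝ → ℝ) (z : ℝ × ℝ) : ℝ := fderiv ℝ φ z (0, 1)

/-- `p` belongs to `H¹` of the domain with weak derivatives `px`, `pt`, and has trace zero on both
lateral boundaries and at the final time `t = T`.  The test functions vanish at `t = 0` only, so
that integration by parts without boundary terms says that the trace of `p` vanishes on the other
parts of the boundary. -/
def HasZeroTraceGradient (k T : ℝ) (p px pt : L2Domain k T) : Prop :=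
  ∀ φ : ℝ × ℝ → ℝ, ContDiff ℝ ∞ φ → HasCompactSupport φ → (∀ x ∈ Icc (0 : ℝ) 1, φ (x, 0) = 0) →
    (∫ z in domain k T, p z * dx φ z) = - ∫ z in domain k T, px z * φ z ∧
    (∫ z in domain k T, p z * dt φ z) = - ∫ z in domain k T, pt z * φ z

/-- Weak form of `p_tt - p_xx = f` in the domain together with `p_t(T) = 0`: the test functions
vanish on the lateral boundaries and at `t = 0`, but are free at `t = T`. -/
def WeakBackwardWave (k T : ℝ) (f px pt : L2Domain k T) : Prop :=
  ∀ φ : ℝ × ℝ → ℝ, ContDiff ℝ ∞ φ → HasCompactSupport φ → (∀ x ∈ Icc (0 : ℝ) 1, φ (x, 0) = 0) →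
    (∀ t ∈ Icc (0 : ℝ) T, φ (0, t) = 0 ∧ φ (1 + k * t, t) = 0) →
    (∫ z in domain k T, (- (pt z * dt φ z) + px z * dx φ z)) = ∫ z in domain k T, f z * φ z

/-- `q` is the trace of `p_x` on the fixed boundary `x = 0`, where `p_tt - p_xx = f`.  The trace is
defined by Green's formula against test functions that are supported away from the moving boundary
and from the times `0` and `T`, but are free on `x = 0`. -/
def HasNormalTrace (k T : ℝ) (f px pt : L2Domain k T) (q : L2Time (Ioo 0 T)) : Prop :=
  ∀ φ : ℝ × ℝ → ℝ, ContDiff ℝ ∞ φ → HasCompactSupport φ →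
    tsupport φ ⊆ {z | 0 < z.2 ∧ z.2 < T ∧ z.1 < 1 + k * z.2} →
    (∫ z in domain k T, (- (pt z * dt φ z) + px z * dx φ z)) =
      (∫ z in domain k T, f z * φ z) - ∫ t in Ioo 0 T, q t * φ (0, t)

/-- `p` is the finite-energy solution of the backward problem
`p_tt - p_xx = f` in the domain, `p = 0` on the lateral boundary, `p(T) = p_t(T) = 0`,
and `q = p_x(0, ·)`. -/
def IsAdjointSolution (k T : ℝ) (f p : L2Domain k T) (q : L2Time (Ioo 0 T)) : Prop :=
  ∃ px pt : L2Domain k T, HasZeroTraceGradient k T p px pt ∧ WeakBackwardWave k T f px pt ∧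
    HasNormalTrace k T f px pt q

/-- `u` is the solution, in the sense of transposition, of
`u_tt - u_xx = 0` in the domain, `u(0, t) = w(t)`, `u(1 + k t, t) = 0`, `u(0) = u_t(0) = 0`. -/
def IsTranspositionSolution (k T : ℝ) (w : ℝ → ℝ) (u : L2Domain k T) : Prop :=
  ∀ (f θ : L2Domain k T) (θx : L2Time (Ioo 0 T)), IsAdjointSolution k T f θ θx →
    (∫ z in domain k T, u z * f z) = ∫ t in Ioo 0 T, w t * θx t

/-- The control on `x = 0` built from `w₁` on `S₁` and `w₂` on `S₂`.  For disjoint `S₁`, `S₂` it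
equals `w₁` on `S₁` and `w₂` on `S₂`; for `S₁ = S₂` it is `w₁ + w₂`. -/
def control (S₁ S₂ : Set ℝ) (w₁ w₂ : ℝ → ℝ) (t : ℝ) : ℝ :=
  S₁.indicator w₁ t + S₂.indicator w₂ t

/-- `u` is the state produced by the controls `w₁`, `w₂`. -/
def IsState (k T : ℝ) (S₁ S₂ : Set ℝ) (w₁ : L2Time S₁) (w₂ : L2Time S₂) (u : L2Domain k T) : Prop :=
  IsTranspositionSolution k T (control S₁ S₂ w₁ w₂) u

/-- The state `u(w₁, w₂)`. -/
def state (k T : ℝ) (S₁ S₂ : Set ℝ) (w₁ : L2Time S₁) (w₂ : L2Time S₂) : L2Domain k T :=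
  Classical.epsilon (IsState k T S₁ S₂ w₁ w₂)

/-- The cost of the follower. -/
def followerCost (k T σ : ℝ) (S₁ S₂ : Set ℝ) (ud : L2Domain k T) (w₁ : L2Time S₁)
    (w₂ : L2Time S₂) : ℝ :=
  (1 / 2) * (∫ z in domain k T, (state k T S₁ S₂ w₁ w₂ z - ud z) ^ 2) +
    (σ / 2) * ∫ t in S₂, (w₂ t) ^ 2

/-- `w₂` is a Nash equilibrium for the leader control `w₁`: it minimizes the follower's cost. -/
def IsNashEquilibrium (k T σ : ℝ) (S₁ S₂ : Set ℝ) (ud : L2Domain k T) (w₁ : L2Time S₁)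
    (w₂ : L2Time S₂) : Prop :=
  ∀ v : L2Time S₂, followerCost k T σ S₁ S₂ ud w₁ w₂ ≤ followerCost k T σ S₁ S₂ ud w₁ v

/-- The optimality system for `{u, p}`, where `q = p_x(0, ·)`: the adjoint equation for `p` with
source `u - ud`, and the state equation for `u` with control `w₁` on `S₁` and
`(1/σ) ∂p/∂ν = -(1/σ) p_x` on `S₂` (the outward normal at `x = 0` is `ν = -1`). -/
def IsOptimalitySystem (k T σ : ℝ) (S₁ S₂ : Set ℝ) (ud : L2Domain k T) (w₁ : L2Time S₁)
    (u p : L2Domain k T) (q : L2Time (Ioo 0 T)) : Prop :=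
  IsAdjointSolution k T (u - ud) p q ∧
    IsTranspositionSolution k T (control S₁ S₂ w₁ (fun t => -(1 / σ) * q t)) u

end MovingWave

end

/-! The whole theorem rests on one bounded operator. Suppose every `f` in L² of the domain has
exactly one adjoint solution, and the hidden trace A : f ↦ θ_x(0,·) is bounded into L²(0,T). Then
the definition by transposition says exactly u = A* w, so the state exists, is unique and depends
linearly on the control. With E₂ the extension by zero and L = A* E₂, the follower's cost is ½‖b + L
v‖² + (σ/2)‖v‖², a strictly convex quadratic whose unique minimizer solves L*(b + L v) + σ v = 0
(`exists_unique_minimizer`). Since L* is A followed by restriction to `S₂`, this equation reads v =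
-(1/σ) p_x on `S₂`, where p is the adjoint solution with source u - u_d. The optimality system is
the normal equation with its intermediate quantities named.

The operator comes from `exists_adjoint_operator`. The sources together with solution, gradient and
trace form a closed linear relation. It is the graph of a bounded operator as soon as it is
single-valued and is solvable with a uniform bound on a dense subspace
(`exists_clm_of_closed_relation`). Single-valuedness is a duality argument against smooth forward
solutions (`adjointGraph_unique`). The bound on smooth sources is an energy identity with a
multiplier adapted to the moving end (`IsSmoothBackward.energy_le`); its boundary term at x = 0 also
controls p_x there.

Both arguments need classical solutions, which are written down explicitly: integrate twice along
characteristics, then correct the boundary values by reflections. Because the end moves slower than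
the waves, only finitely many reflections occur before time T (`exists_reflection`). -/

noncomputable section

namespace MovingWave

/-! ### Calculus of directional derivatives -/

/-- The derivative of `φ` in the direction `v`. -/
def dirDeriv (v : ℝ × ℝ) (φ : ℝ × ℝ → ℝ) (z : ℝ × ℝ) : ℝ := fderiv ℝ φ z v

theorem dx_eq_dirDeriv (φ : ℝ × ℝ → ℝ) : dx φ = dirDeriv (1, 0) φ := rfl

theorem dt_eq_dirDeriv (φ : ℝ × ℝ → ℝ) : dt φ = dirDeriv (0, 1) φ := rfl

theorem contDiff_dirDeriv {φ : ℝ × ℝ → ℝ} (hφ : ContDiff ℝ ∞ φ) (v : ℝ × ℝ) :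
    ContDiff ℝ ∞ (dirDeriv v φ) :=
  (hφ.fderiv_right (m := ∞) (by simp)).clm_apply contDiff_const

theorem contDiff_dx {φ : ℝ × ℝ → ℝ} (hφ : ContDiff ℝ ∞ φ) : ContDiff ℝ ∞ (dx φ) :=
  contDiff_dirDeriv hφ _

theorem contDiff_dt {φ : ℝ × ℝ → ℝ} (hφ : ContDiff ℝ ∞ φ) : ContDiff ℝ ∞ (dt φ) :=
  contDiff_dirDeriv hφ _

theorem differentiable_of_smooth {φ : ℝ × ℝ → ℝ} (hφ : ContDiff ℝ ∞ φ) : Differentiable ℝ φ :=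
  hφ.differentiable (by simp)

theorem hasDerivAt_line {φ : ℝ × ℝ → ℝ} (hφ : ContDiff ℝ ∞ φ) {γ : ℝ → ℝ × ℝ} {γ' : ℝ × ℝ} {s : ℝ}
    (hγ : HasDerivAt γ γ' s) : HasDerivAt (fun s => φ (γ s)) (dirDeriv γ' φ (γ s)) s :=
  ((differentiable_of_smooth hφ _).hasFDerivAt).comp_hasDerivAt s hγ

theorem hasDerivAt_dx {φ : ℝ × ℝ → ℝ} (hφ : ContDiff ℝ ∞ φ) (x t : ℝ) :
    HasDerivAt (fun x => φ (x, t)) (dx φ (x, t)) x :=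
  hasDerivAt_line hφ ((hasDerivAt_id x).prodMk (hasDerivAt_const x t))

theorem hasDerivAt_dt {φ : ℝ × ℝ → ℝ} (hφ : ContDiff ℝ ∞ φ) (x t : ℝ) :
    HasDerivAt (fun t => φ (x, t)) (dt φ (x, t)) t :=
  hasDerivAt_line hφ ((hasDerivAt_const t x).prodMk (hasDerivAt_id t))

theorem dirDeriv_eq (φ : ℝ × ℝ → ℝ) (a b : ℝ) (z : ℝ × ℝ) :
    dirDeriv (a, b) φ z = a * dx φ z + b * dt φ z := by
  have : ((a, b) : ℝ × ℝ) = a • (1, 0) + b • (0, 1) := by simp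
  simp only [dirDeriv, dx, dt]
  rw [this, map_add, map_smul, map_smul, smul_eq_mul, smul_eq_mul]

theorem dirDeriv_dirDeriv {φ : ℝ × ℝ → ℝ} (hφ : ContDiff ℝ ∞ φ) (v w z : ℝ × ℝ) :
    dirDeriv w (dirDeriv v φ) z = fderiv ℝ (fderiv ℝ φ) z w v := by
  have h1 : DifferentiableAt ℝ (fderiv ℝ φ) z :=
    (hφ.fderiv_right (m := ∞) (by simp)).differentiable (by simp) z
  have : dirDeriv v φ = fun z => fderiv ℝ φ z v := rfl
  rw [dirDeriv, this, fderiv_clm_apply h1 (differentiableAt_const _)]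
  simp

theorem dirDeriv_comm {φ : ℝ × ℝ → ℝ} (hφ : ContDiff ℝ ∞ φ) (v w z : ℝ × ℝ) :
    dirDeriv w (dirDeriv v φ) z = dirDeriv v (dirDeriv w φ) z := by
  rw [dirDeriv_dirDeriv hφ, dirDeriv_dirDeriv hφ]
  exact (hφ.contDiffAt.isSymmSndFDerivAt (by
    rw [minSmoothness_of_isRCLikeNormedField]
    exact WithTop.coe_le_coe.2 (le_top : (2 : ℕ∞) ≤ ⊤))).eq _ _

theorem dt_dx_comm {φ : ℝ × ℝ → ℝ} (hφ : ContDiff ℝ ∞ φ) (z : ℝ × ℝ) :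
    dt (dx φ) z = dx (dt φ) z :=
  dirDeriv_comm hφ _ _ z

theorem dirDeriv_comp {φ : ℝ × ℝ → ℝ} (hφ : ContDiff ℝ ∞ φ) {L : ℝ × ℝ → ℝ × ℝ}
    {L' : ℝ × ℝ →L[ℝ] ℝ × ℝ} (hL : ∀ z, HasFDerivAt L L' z) (v : ℝ × ℝ) :
    dirDeriv v (fun z => φ (L z)) = fun z => dirDeriv (L' v) φ (L z) := by
  funext z
  have := ((differentiable_of_smooth hφ (L z)).hasFDerivAt).comp z (hL z)
  rw [dirDeriv, HasFDerivAt.fderiv (f := fun z => φ (L z)) this]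
  rfl

/-! ### Antiderivatives and characteristic coordinates -/

/-- A smooth antiderivative in the first variable, vanishing to the left of the support. -/
theorem exists_antideriv {h : ℝ × ℝ → ℝ} (hh : ContDiff ℝ ∞ h) {a b : ℝ}
    (hs : ∀ x y, x ∉ Icc a b → h (x, y) = 0) :
    ∃ K : ℝ × ℝ → ℝ, ContDiff ℝ ∞ K ∧ (∀ z, dx K z = h z) ∧
      ∀ x y, (∀ s ≤ x, h (s, y) = 0) → K (x, y) = 0 := by
  set K : ℝ × ℝ → ℝ := fun z => ∫ s in Iic z.1, h (s, z.2) with hK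
  have hint : ∀ y, Integrable (fun s => h (s, y)) := fun y =>
    (hh.continuous.comp (by fun_prop : Continuous fun s : ℝ => (s, y))).integrable_of_hasCompactSupport
      (HasCompactSupport.intro (isCompact_Icc (a := a) (b := b)) fun x hx => hs x y hx)
  -- The antiderivative is the convolution of `h (·, y)` with the Heaviside function; smoothness of
  -- convolutions with a parameter gives joint smoothness in both variables.
  have hconv : ContDiff ℝ ∞ fun q : ℝ × ℝ =>
      convolution ((Ici (0 : ℝ)).indicator fun _ => (1 : ℝ)) (fun s => h (s, q.1))
        (ContinuousLinearMap.mul ℝ ℝ) volume q.2 := by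
    rw [← contDiffOn_univ, ← univ_prod_univ]
    refine contDiffOn_convolution_right_with_param (n := ⊤) (ContinuousLinearMap.mul ℝ ℝ)
      (g := fun y s => h (s, y)) isOpen_univ
      (isCompact_Icc (a := a) (b := b)) (fun p x _ hx => hs x p hx) ?_ ?_
    · exact (locallyIntegrable_const (1 : ℝ)).indicator measurableSet_Ici
    · exact ((hh.comp (contDiff_snd.prodMk contDiff_fst)).contDiffOn)
  have hKeq : K = fun z => convolution ((Ici (0 : ℝ)).indicator fun _ => (1 : ℝ))
      (fun s => h (s, z.2)) (ContinuousLinearMap.mul ℝ ℝ) volume z.1 := by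
    funext z
    rw [convolution_def, ← integral_sub_left_eq_self _ _ z.1, hK]
    simp only
    rw [← integral_indicator measurableSet_Iic]
    congr 1
    funext s
    by_cases hsz : s ≤ z.1 <;> simp [indicator, hsz]
  have hKs : ContDiff ℝ ∞ K := by
    rw [hKeq]
    exact hconv.comp (contDiff_snd.prodMk contDiff_fst)
  refine ⟨K, hKs, ?_, ?_⟩
  · rintro ⟨x, y⟩
    refine (hasDerivAt_dx hKs x y).unique ?_
    have hc : Continuous fun s => h (s, y) := hh.continuous.comp (by fun_prop)
    have h1 : (fun x => K (x, y)) = fun x => (∫ s in Iic a, h (s, y)) + ∫ s in a..x, h (s, y) := by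
      funext x
      rw [← intervalIntegral.integral_Iic_sub_Iic (hint y).integrableOn (hint y).integrableOn]
      simp [hK]
    rw [h1]
    exact (intervalIntegral.integral_hasDerivAt_right (hc.intervalIntegrable _ _)
      (hc.stronglyMeasurableAtFilter _ _) hc.continuousAt).const_add _
  · intro x y hxy
    exact setIntegral_eq_zero_of_forall_eq_zero fun s hs => hxy s hs

theorem dt_comp_swap {φ : ℝ × ℝ → ℝ} (hφ : ContDiff ℝ ∞ φ) (z : ℝ × ℝ) :
    dt (fun z => φ z.swap) z = dx φ z.swap := by
  have h := congrFun (dirDeriv_comp hφ (L := Prod.swap)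
    (fun z => ((ContinuousLinearMap.snd ℝ ℝ ℝ).prod
      (ContinuousLinearMap.fst ℝ ℝ ℝ)).hasFDerivAt) (0, 1)) z
  simpa [dt_eq_dirDeriv, dx_eq_dirDeriv] using h

/-- In characteristic coordinates the wave operator is a mixed derivative, so one antiderivative in
each variable inverts it. The vanishing clause is the domain of dependence, a quadrant. -/
theorem exists_antideriv_antideriv {h : ℝ × ℝ → ℝ} (hh : ContDiff ℝ ∞ h)
    (hc : HasCompactSupport h) :
    ∃ K : ℝ × ℝ → ℝ, ContDiff ℝ ∞ K ∧ (∀ z, dx (dt K) z = h z) ∧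
      ∀ x y, (∀ s ≤ x, ∀ r ≤ y, h (s, r) = 0) → K (x, y) = 0 := by
  obtain ⟨R, hR⟩ := hc.isCompact.isBounded.subset_closedBall (0 : ℝ × ℝ)
  have hz : ∀ z : ℝ × ℝ, (z.1 ∉ Icc (-R) R ∨ z.2 ∉ Icc (-R) R) → h z = 0 := by
    intro z hz
    by_contra hne
    have h1 := hR (subset_tsupport _ hne)
    rw [mem_closedBall_zero_iff, Prod.norm_def, max_le_iff, Real.norm_eq_abs,
      Real.norm_eq_abs, abs_le, abs_le] at h1
    rcases hz with hz | hz
    · exact hz h1.1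
    · exact hz h1.2
  obtain ⟨K₁, hK₁, hd₁, hv₁⟩ := exists_antideriv hh (a := -R) (b := R) fun x y hx => hz _ (Or.inl hx)
  obtain ⟨K₂, hK₂, hd₂, hv₂⟩ := exists_antideriv (h := fun z => K₁ z.swap) (a := -R) (b := R)
    (hK₁.comp (contDiff_snd.prodMk contDiff_fst))
    fun x y hx => hv₁ _ _ fun s _ => hz _ (Or.inr hx)
  refine ⟨fun z => K₂ z.swap, hK₂.comp (contDiff_snd.prodMk contDiff_fst), ?_, ?_⟩
  · intro z
    have : dt (fun z => K₂ z.swap) = K₁ := by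
      funext z
      rw [dt_comp_swap hK₂, hd₂, Prod.swap_swap]
    rw [this, hd₁]
  · intro x y hxy
    exact hv₂ _ _ fun r hr => hv₁ _ _ fun s hs => hxy s hs r hr

/-- The time and space directions are sent to e₁ + e₂ and e₁ - e₂, and for the symmetric form D²U
the difference of the two diagonal values is four times the off-diagonal one. -/
theorem wave_comp_characteristic {U : ℝ × ℝ → ℝ} (hU : ContDiff ℝ ∞ U) (z : ℝ × ℝ) :
    dt (dt fun z => U (z.2 + z.1, z.2 - z.1)) z - dx (dx fun z => U (z.2 + z.1, z.2 - z.1)) z =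
      4 * dx (dt U) (z.2 + z.1, z.2 - z.1) := by
  set L' : ℝ × ℝ →L[ℝ] ℝ × ℝ :=
    (ContinuousLinearMap.snd ℝ ℝ ℝ + ContinuousLinearMap.fst ℝ ℝ ℝ).prod
      (ContinuousLinearMap.snd ℝ ℝ ℝ - ContinuousLinearMap.fst ℝ ℝ ℝ) with hL'
  have hL : ∀ z, HasFDerivAt (fun z : ℝ × ℝ => (z.2 + z.1, z.2 - z.1)) L' z :=
    fun z => L'.hasFDerivAt
  have h2 : ∀ v, dirDeriv v (dirDeriv v fun z => U (z.2 + z.1, z.2 - z.1)) z =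
      fderiv ℝ (fderiv ℝ U) (z.2 + z.1, z.2 - z.1) (L' v) (L' v) := by
    intro v
    rw [dirDeriv_comp hU hL, dirDeriv_comp (contDiff_dirDeriv hU _) hL]
    exact dirDeriv_dirDeriv hU _ _ _
  rw [dx_eq_dirDeriv, dt_eq_dirDeriv, dx_eq_dirDeriv, dt_eq_dirDeriv, h2, h2, dx_eq_dirDeriv,
    dt_eq_dirDeriv, dirDeriv_dirDeriv hU]
  have hs := dirDeriv_comm hU (1, 0) (0, 1) (z.2 + z.1, z.2 - z.1)
  rw [dirDeriv_dirDeriv hU, dirDeriv_dirDeriv hU] at hs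
  have e1 : L' (0, 1) = (1, 0) + (0, 1) := by simp [hL']
  have e2 : L' (1, 0) = (1, 0) - (0, 1) := by simp [hL']
  rw [e1, e2]
  simp only [map_add, map_sub, add_apply, sub_apply]
  rw [hs]
  ring

/-! ### Classical solutions by reflection -/

/-- Absorbing the boundary values `r` at the moving end by finitely many reflections. -/
theorem exists_reflection {l k T ε : ℝ} (hk0 : -1 < k) (hk1 : k < 1) (hT : 0 < T) (hl : 0 < l)
    (hlT : 0 < l + k * T) (hε : 0 < ε) (hεT : ε < T) {r : ℝ → ℝ} (hr : ContDiff ℝ ∞ r)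
    (hr0 : ∀ t ≤ ε, r t = 0) :
    ∃ H : ℝ → ℝ, ContDiff ℝ ∞ H ∧
      (∀ t ≤ T, H ((1 + k) * t + l) - H ((1 - k) * t - l) = - r t) ∧
      ∀ a ≤ l + (1 + k) * ε, H a = 0 := by
  have hk : 0 < 1 + k := by linarith
  have hlε : 0 < l + k * ε := by
    rcases le_or_gt 0 k with h | h
    · positivity
    · nlinarith
  -- `τ a` is the time at which the characteristic t + x = a meets the moving end, and `m a` is the
  -- value of t - x there. At x = 0 both coordinates agree, so `m` is one round trip backwards; `s`
  -- is the same map in terms of hitting times. The equation becomes H(a) - H(m a) = -r(τ a), solved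
  -- by a telescoping sum over iterates of `m`.
  set τ : ℝ → ℝ := fun a => (a - l) / (1 + k) with hτ
  set m : ℝ → ℝ := fun a => (1 - k) * τ a - l with hm
  set s : ℝ → ℝ := fun t => ((1 - k) * t - 2 * l) / (1 + k) with hs
  have hmono : Monotone s := fun x y hxy => by
    simp only [hs]
    gcongr
  have hsemi : Function.Semiconj τ m s := fun a => by
    simp only [hτ, hm, hs]
    ring
  have hmc : ContDiff ℝ ∞ m := by
    simp only [hm, hτ]
    fun_prop
  have hτc : ContDiff ℝ ∞ τ := by
    simp only [hτ]
    fun_prop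
  have hmi : ∀ n : ℕ, ContDiff ℝ ∞ m^[n] := fun n => by
    induction n with
    | zero => exact contDiff_id
    | succ n ih =>
      rw [Function.iterate_succ']
      exact hmc.comp ih
  -- One round trip takes t - s(t) = 2(l + k t)/(1 + k). This is affine in t, so its minimum over
  -- [0, T] is attained at an endpoint.
  obtain ⟨δ, hδ, hδ1, hδ2⟩ : ∃ δ > 0, (1 + k) * δ ≤ 2 * l ∧ (1 + k) * δ ≤ 2 * (l + k * T) := by
    refine ⟨2 * min l (l + k * T) / (1 + k), by positivity, ?_, ?_⟩
    · rw [mul_div_cancel₀ _ hk.ne']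
      linarith [min_le_left l (l + k * T)]
    · rw [mul_div_cancel₀ _ hk.ne']
      linarith [min_le_right l (l + k * T)]
  have hstep : ∀ t ≤ T, ∀ n : ℕ, s^[n] t ≤ max 0 (T - n * δ) := by
    intro t ht n
    induction n with
    | zero => simp [ht]
    | succ n ih =>
      rw [Function.iterate_succ_apply']
      refine (hmono ih).trans ?_
      set y := max 0 (T - n * δ) with hy
      have hy0 : 0 ≤ y := le_max_left _ _
      have hyT : y ≤ T := by
        refine max_le hT.le ?_
        have : 0 ≤ n * δ := by positivity
        linarith
      have hyd : s y ≤ y - δ := by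
        simp only [hs]
        rw [div_le_iff₀ hk]
        rcases le_or_gt 0 k with h | h
        · nlinarith [mul_nonneg h hy0]
        · nlinarith
      refine hyd.trans ?_
      rcases max_choice 0 (T - n * δ) with h | h
      · rw [hy, h]
        exact le_max_of_le_left (by linarith)
      · rw [hy, h]
        refine le_max_of_le_right ?_
        push_cast
        linarith
  have hsε : ∀ t ≤ ε, ∀ n : ℕ, s^[n] t ≤ ε := by
    intro t ht n
    induction n with
    | zero => simpa using ht
    | succ n ih =>
      rw [Function.iterate_succ_apply']
      refine (hmono ih).trans ?_
      simp only [hs]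
      rw [div_le_iff₀ hk]
      nlinarith
  -- After `N` trips every time up to `T` has been pushed to 0 or below, where `r` vanishes; this
  -- kills the last term of the telescoping sum.
  obtain ⟨N, hN⟩ := exists_nat_gt (T / δ)
  rw [div_lt_iff₀ hδ] at hN
  refine ⟨fun a => - ∑ n ∈ Finset.range N, r (τ (m^[n] a)), ?_, ?_, ?_⟩
  · exact (ContDiff.sum fun n _ => hr.comp (hτc.comp (hmi n))).neg
  · intro t ht
    have hma : (1 - k) * t - l = m ((1 + k) * t + l) := by
      simp only [hm, hτ]
      field_simp
      ring
    have hta : τ ((1 + k) * t + l) = t := by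
      simp only [hτ]
      field_simp
      ring
    set a := (1 + k) * t + l with ha
    have h1 : ∑ n ∈ Finset.range N, r (τ (m^[n] (m a))) - ∑ n ∈ Finset.range N, r (τ (m^[n] a)) =
        r (τ (m^[N] a)) - r (τ a) := by
      rw [← Finset.sum_sub_distrib]
      simp only [← Function.iterate_succ_apply]
      exact Finset.sum_range_sub (fun n => r (τ (m^[n] a))) N
    have h2 : r (τ (m^[N] a)) = 0 := by
      rw [(hsemi.iterate_right N).eq, hta]
      refine hr0 _ (((hstep t ht N).trans (max_le le_rfl (by linarith))).trans hε.le)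
    rw [hma]
    rw [h2, hta] at h1
    linarith
  · intro a ha
    simp only [neg_eq_zero]
    refine Finset.sum_eq_zero fun n _ => ?_
    rw [(hsemi.iterate_right n).eq]
    refine hr0 _ (hsε _ ?_ n)
    simp only [hτ]
    rw [div_le_iff₀ hk]
    linarith

/-- Smooth solutions of the inhomogeneous wave equation, starting from rest, between the fixed
end `x = 0` and the end `x = l + k t` moving at a subsonic speed. -/
theorem exists_smooth_wave {l k T ε : ℝ} (hk0 : -1 < k) (hk1 : k < 1) (hT : 0 < T) (hl : 0 < l)
    (hlT : 0 < l + k * T) (hε : 0 < ε) (hεT : ε < T) {g : ℝ × ℝ → ℝ} (hg : ContDiff ℝ ∞ g)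
    (hgc : HasCompactSupport g) (hg0 : ∀ z : ℝ × ℝ, z.2 ≤ ε → g z = 0) :
    ∃ φ : ℝ × ℝ → ℝ, ContDiff ℝ ∞ φ ∧ (∀ z, dt (dt φ) z - dx (dx φ) z = g z) ∧
      (∀ t, φ (0, t) = 0) ∧ (∀ t ≤ T, φ (l + k * t, t) = 0) ∧
      ∀ x t, t ≤ ε → t - x ≤ ε → t + x ≤ l + (1 + k) * ε → φ (x, t) = 0 := by
  have hlε : 0 < l + k * ε := by
    rcases le_or_gt 0 k with h | h
    · positivity
    · nlinarith
  -- The map from characteristic coordinates (t + x, t - x) back to (x, t).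
  set M : (ℝ × ℝ) ≃L[ℝ] (ℝ × ℝ) := ContinuousLinearEquiv.equivOfInverse
    (((1 / 2 : ℝ) • (ContinuousLinearMap.fst ℝ ℝ ℝ - ContinuousLinearMap.snd ℝ ℝ ℝ)).prod
      ((1 / 2 : ℝ) • (ContinuousLinearMap.fst ℝ ℝ ℝ + ContinuousLinearMap.snd ℝ ℝ ℝ)))
    ((ContinuousLinearMap.snd ℝ ℝ ℝ + ContinuousLinearMap.fst ℝ ℝ ℝ).prod
      (ContinuousLinearMap.snd ℝ ℝ ℝ - ContinuousLinearMap.fst ℝ ℝ ℝ))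
    (fun z => by ext <;> simp <;> ring) (fun z => by ext <;> simp <;> ring) with hM
  have hMz : ∀ a b, M (a, b) = ((a - b) / 2, (a + b) / 2) := by
    intro a b
    ext <;> simp [hM] <;> ring
  set h : ℝ × ℝ → ℝ := fun z => g (M z) / 4 with hh
  have hhc : ContDiff ℝ ∞ h := (hg.comp M.contDiff).div_const 4
  have hhs : HasCompactSupport h := by
    have : HasCompactSupport (g ∘ M) := hgc.comp_homeomorph M.toHomeomorph
    refine this.mono fun z hz => ?_
    simp only [hh, Function.mem_support, ne_eq, div_eq_zero_iff, not_or] at hz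
    exact hz.1
  obtain ⟨K, hK, hKd, hKv⟩ := exists_antideriv_antideriv hhc hhs
  have hK0 : ∀ a b, a + b ≤ 2 * ε → K (a, b) = 0 := by
    intro a b hab
    refine hKv a b fun s hs r hr => ?_
    simp only [hh, hMz]
    rw [hg0 _ (by simp only; linarith), zero_div]
  obtain ⟨H, hH, hHr, hH0⟩ := exists_reflection hk0 hk1 hT hl hlT hε hεT
    (r := fun t => K ((1 + k) * t + l, (1 - k) * t - l) - K ((1 - k) * t - l, (1 - k) * t - l))
    ((hK.comp (by fun_prop)).sub (hK.comp (by fun_prop)))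
    (fun t ht => by
      rw [hK0 _ _ (by linarith), hK0 _ _ (by nlinarith), sub_zero])
  -- The terms added to `K` each depend on one characteristic variable, so the mixed derivative
  -- ignores them. The combination vanishes on the diagonal, that is at x = 0, and `H` was chosen to
  -- cancel the remaining values at the moving end.
  have hU : ContDiff ℝ ∞ fun z : ℝ × ℝ => K z - K (z.2, z.2) + H z.1 - H z.2 :=
    ((hK.sub (hK.comp (by fun_prop))).add (hH.comp contDiff_fst)).sub (hH.comp contDiff_snd)
  refine ⟨fun z => (fun z : ℝ × ℝ => K z - K (z.2, z.2) + H z.1 - H z.2) (z.2 + z.1, z.2 - z.1),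
    hU.comp (by fun_prop), ?_, ?_, ?_, ?_⟩
  · intro z
    rw [wave_comp_characteristic hU]
    have hB : ContDiff ℝ ∞ fun y : ℝ => K (y, y) + H y := (hK.comp (by fun_prop)).add hH
    have h1 : dt (fun z : ℝ × ℝ => K z - K (z.2, z.2) + H z.1 - H z.2) =
        fun z => dt K z - deriv (fun y => K (y, y) + H y) z.2 := by
      funext ⟨x, y⟩
      refine (hasDerivAt_dt hU x y).unique ?_
      refine (((hasDerivAt_dt hK x y).sub
        (hB.differentiable (by simp) y).hasDerivAt).add_const (H x)).congr_of_eventuallyEq ?_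
      refine Filter.Eventually.of_forall fun y => ?_
      simp only [Pi.sub_apply]
      ring
    have h2 : ∀ x y, dx (fun z => dt K z - deriv (fun y => K (y, y) + H y) z.2) (x, y) =
        dx (dt K) (x, y) := by
      intro x y
      refine (hasDerivAt_dx (h1 ▸ contDiff_dt hU) x y).unique ?_
      exact (hasDerivAt_dx (contDiff_dt hK) x y).sub_const (deriv (fun y => K (y, y) + H y) y)
    rw [h1, h2, hKd]
    simp only [hh, hMz]
    ring_nf
  · intro t
    simp
  · intro t ht
    have h1 := hHr t ht
    have e1 : t + (l + k * t) = (1 + k) * t + l := by ring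
    have e2 : t - (l + k * t) = (1 - k) * t - l := by ring
    simp only [e1, e2]
    linarith
  · intro x t h1 h2 h3
    simp only
    rw [hK0 _ _ (by linarith), hK0 _ _ (by linarith), hH0 _ (by linarith), hH0 _ (by linarith)]
    simp

theorem dirDeriv_congr {φ ψ : ℝ × ℝ → ℝ} {U : Set (ℝ × ℝ)} (hU : IsOpen U)
    (h : ∀ z ∈ U, φ z = ψ z) (v : ℝ × ℝ) : ∀ z ∈ U, dirDeriv v φ z = dirDeriv v ψ z := by
  intro z hz
  have : φ =ᶠ[nhds z] ψ := Filter.eventually_of_mem (hU.mem_nhds hz) h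
  rw [dirDeriv, dirDeriv, this.fderiv_eq]

theorem exists_time_margin {k T : ℝ} (hT : 0 < T) {g : ℝ × ℝ → ℝ} (hgc : HasCompactSupport g)
    (hgs : tsupport g ⊆ domain k T) :
    ∃ ε > 0, ε < T ∧ (∀ z : ℝ × ℝ, z.2 ≤ ε → g z = 0) ∧ ∀ z : ℝ × ℝ, T - ε ≤ z.2 → g z = 0 := by
  obtain ⟨a, ha, h⟩ := hgc.isCompact.exists_forall_le' (f := fun z : ℝ × ℝ => min z.2 (T - z.2))
    (by fun_prop) (a := 0) (fun z hz => by
      have := hgs hz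
      exact lt_min this.1 (by linarith [this.2.1]))
  have key : ∀ z : ℝ × ℝ, g z ≠ 0 → a ≤ z.2 ∧ a ≤ T - z.2 := fun z hz =>
    le_min_iff.1 (h z (subset_tsupport _ hz))
  refine ⟨min a T / 2, by positivity, ?_, fun z hz => ?_, fun z hz => ?_⟩
  · linarith [min_le_right a T]
  · by_contra hne
    linarith [key z hne, min_le_left a T]
  · by_contra hne
    linarith [(key z hne).2, min_le_left a T]

/-- The region where the solution is known to vanish contains an open neighbourhood of the initial
segment, so its first derivatives vanish there as well. -/
theorem exists_wave_at_rest {l k T ε : ℝ} (hk0 : -1 < k) (hk1 : k < 1) (hT : 0 < T) (hl : 0 < l)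
    (hlT : 0 < l + k * T) (hε : 0 < ε) (hεT : ε < T) {g : ℝ × ℝ → ℝ} (hg : ContDiff ℝ ∞ g)
    (hgc : HasCompactSupport g) (hg0 : ∀ z : ℝ × ℝ, z.2 ≤ ε → g z = 0) :
    ∃ φ : ℝ × ℝ → ℝ, ContDiff ℝ ∞ φ ∧ (∀ z, dt (dt φ) z - dx (dx φ) z = g z) ∧
      (∀ t, φ (0, t) = 0) ∧ (∀ t ≤ T, φ (l + k * t, t) = 0) ∧
      ∀ x ∈ Icc 0 l, φ (x, 0) = 0 ∧ dx φ (x, 0) = 0 ∧ dt φ (x, 0) = 0 := by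
  obtain ⟨φ, hφ, hw, h0, hl', hv⟩ := exists_smooth_wave hk0 hk1 hT hl hlT hε hεT hg hgc hg0
  refine ⟨φ, hφ, hw, h0, hl', ?_⟩
  set U : Set (ℝ × ℝ) := {z | z.2 < ε ∧ z.2 - z.1 < ε ∧ z.2 + z.1 < l + (1 + k) * ε} with hU
  have hUo : IsOpen U := by
    exact (isOpen_lt continuous_snd continuous_const).inter
      ((isOpen_lt (continuous_snd.sub continuous_fst) continuous_const).inter
        (isOpen_lt (continuous_snd.add continuous_fst) continuous_const))
  have hz : ∀ z ∈ U, φ z = (fun _ => 0) z := fun z hz => hv z.1 z.2 hz.1.le hz.2.1.le hz.2.2.le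
  have hd : ∀ v, ∀ z ∈ U, dirDeriv v φ z = 0 := fun v z hz' => by
    rw [dirDeriv_congr hUo hz v z hz']
    simp [dirDeriv]
  intro x hx
  have hxU : (x, (0 : ℝ)) ∈ U := by
    refine ⟨hε, by simp only; linarith [hx.1], ?_⟩
    have : 0 < (1 + k) * ε := mul_pos (by linarith) hε
    simp only
    linarith [hx.2]
  exact ⟨hz _ hxU, hd _ _ hxU, hd _ _ hxU⟩

/-- Time reversal gives a forward problem whose end starts at 1 + k T and moves with speed -k; this
is why the reflections were carried out for speeds of either sign. -/
theorem exists_smooth_backward {k T : ℝ} (hk0 : 0 < k) (hk1 : k < 1) (hT : 0 < T)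
    {g : ℝ × ℝ → ℝ} (hg : ContDiff ℝ ∞ g) (hgc : HasCompactSupport g)
    (hgs : tsupport g ⊆ domain k T) :
    ∃ p : ℝ × ℝ → ℝ, ContDiff ℝ ∞ p ∧ (∀ z, dt (dt p) z - dx (dx p) z = g z) ∧
      (∀ t, p (0, t) = 0) ∧ (∀ t, 0 ≤ t → p (1 + k * t, t) = 0) ∧
      ∀ x ∈ Icc 0 (1 + k * T), p (x, T) = 0 ∧ dx p (x, T) = 0 ∧ dt p (x, T) = 0 := by
  obtain ⟨ε, hε, hεT, -, hg0⟩ := exists_time_margin hT hgc hgs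
  have hkT : 0 < k * T := mul_pos hk0 hT
  set L' : ℝ × ℝ →L[ℝ] ℝ × ℝ :=
    (ContinuousLinearMap.fst ℝ ℝ ℝ).prod (-ContinuousLinearMap.snd ℝ ℝ ℝ) with hL'
  have hL : ∀ z, HasFDerivAt (fun z : ℝ × ℝ => (z.1, T - z.2)) L' z := fun z =>
    hasFDerivAt_fst.prodMk (hasFDerivAt_snd.const_sub T)
  have hgc' : HasCompactSupport fun z : ℝ × ℝ => g (z.1, T - z.2) :=
    hgc.comp_homeomorph ((Homeomorph.refl ℝ).prodCongr (Homeomorph.subLeft T))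
  obtain ⟨φ, hφ, hw, h0, hl, hv⟩ := exists_wave_at_rest (l := 1 + k * T) (k := -k) (by linarith)
    (by linarith) hT (by linarith) (by linarith) hε hεT (g := fun z => g (z.1, T - z.2))
    (hg.comp (by fun_prop)) hgc' (fun z hz => hg0 _ (by simp only; linarith))
  have hd : ∀ v, dirDeriv v (fun z : ℝ × ℝ => φ (z.1, T - z.2)) =
      fun z => dirDeriv (L' v) φ (z.1, T - z.2) := fun v => dirDeriv_comp hφ hL v
  have hdd : ∀ v z, dirDeriv v (dirDeriv v fun z : ℝ × ℝ => φ (z.1, T - z.2)) z =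
      fderiv ℝ (fderiv ℝ φ) (z.1, T - z.2) (L' v) (L' v) := by
    intro v z
    rw [hd, dirDeriv_comp (contDiff_dirDeriv hφ _) hL]
    exact dirDeriv_dirDeriv hφ _ _ _
  have e1 : L' (1, 0) = (1, 0) := by simp [hL']
  have e2 : L' (0, 1) = -(0, 1) := by simp [hL']
  refine ⟨fun z => φ (z.1, T - z.2), hφ.comp (by fun_prop), ?_, ?_, ?_, ?_⟩
  · intro z
    have h := hw (z.1, T - z.2)
    simp only [sub_sub_cancel] at h
    rw [← h]
    simp only [dx_eq_dirDeriv, dt_eq_dirDeriv, hdd, e1, e2, dirDeriv_dirDeriv hφ]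
    simp only [map_neg, neg_apply, neg_neg]
  · intro t
    exact h0 _
  · intro t ht
    have := hl (T - t) (by linarith)
    rw [← this]
    ring_nf
  · intro x hx
    have := hv x hx
    simp only [dx_eq_dirDeriv, dt_eq_dirDeriv] at this ⊢
    rw [hd, hd]
    simp only [e1, e2, sub_self]
    refine ⟨this.1, this.2.1, ?_⟩
    have h3 := this.2.2
    simp only [dirDeriv, map_neg, neg_eq_zero] at h3 ⊢
    exact h3

theorem exists_smooth_forward {k T : ℝ} (hk0 : 0 < k) (hk1 : k < 1) (hT : 0 < T)
    {g : ℝ × ℝ → ℝ} (hg : ContDiff ℝ ∞ g) (hgc : HasCompactSupport g)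
    (hgs : tsupport g ⊆ domain k T) :
    ∃ φ : ℝ × ℝ → ℝ, ContDiff ℝ ∞ φ ∧ HasCompactSupport φ ∧
      (∀ z ∈ domain k T, dt (dt φ) z - dx (dx φ) z = g z) ∧
      (∀ t ∈ Icc 0 T, φ (0, t) = 0 ∧ φ (1 + k * t, t) = 0) ∧
      ∀ x ∈ Icc (0 : ℝ) 1, φ (x, 0) = 0 ∧ dx φ (x, 0) = 0 ∧ dt φ (x, 0) = 0 := by
  obtain ⟨ε, hε, hεT, hg0, -⟩ := exists_time_margin hT hgc hgs
  have hkT : 0 < k * T := mul_pos hk0 hT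
  have hkT' : k * T < T := by nlinarith
  obtain ⟨ψ, hψ, hw, h0, hl, hv⟩ := exists_wave_at_rest (l := 1) (k := k) (by linarith)
    hk1 hT one_pos (by linarith) hε hεT hg hgc hg0
  -- Admissible test functions have compact support. This cutoff equals 1 on a ball containing the
  -- domain, because 1 + k T < 2 + T, so equation and initial data are unaffected.
  let χ : ContDiffBump (0 : ℝ × ℝ) := ⟨2 + T, 3 + T, by linarith, by linarith⟩
  set U : Set (ℝ × ℝ) := Metric.ball 0 (2 + T) with hU
  have hmem : ∀ x t : ℝ, U (x, t) ↔ |x| < 2 + T ∧ |t| < 2 + T := by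
    intro x t
    change (x, t) ∈ Metric.ball (0 : ℝ × ℝ) (2 + T) ↔ _
    rw [mem_ball_zero_iff, Prod.norm_def, max_lt_iff]
    rfl
  have hUo : IsOpen U := Metric.isOpen_ball
  have hχ : ∀ z ∈ U, χ z * ψ z = ψ z := fun z hz => by
    rw [χ.one_of_mem_closedBall (Metric.ball_subset_closedBall hz), one_mul]
  have h1 : ∀ v, ∀ z ∈ U, dirDeriv v (fun z => χ z * ψ z) z = dirDeriv v ψ z :=
    dirDeriv_congr hUo hχ
  have h2 : ∀ v, ∀ z ∈ U, dirDeriv v (dirDeriv v fun z => χ z * ψ z) z =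
      dirDeriv v (dirDeriv v ψ) z := fun v => dirDeriv_congr hUo (h1 v) v
  refine ⟨fun z => χ z * ψ z, χ.contDiff.mul hψ, χ.hasCompactSupport.mul_right, ?_, ?_, ?_⟩
  · intro z hz
    have hzU : z ∈ U := by
      refine (hmem z.1 z.2).2 ⟨?_, ?_⟩ <;> rw [abs_lt] <;> constructor <;>
        nlinarith [hz.1, hz.2.1, hz.2.2.1, hz.2.2.2]
    rw [← hw z]
    exact congrArg₂ (· - ·) (h2 _ z hzU) (h2 _ z hzU)
  · intro t ht
    simp only [h0 t, hl t ht.2, mul_zero, and_self]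
  · intro x hx
    have hxU : (x, (0 : ℝ)) ∈ U := by
      refine (hmem x 0).2 ⟨?_, ?_⟩ <;> rw [abs_lt] <;> constructor <;> linarith [hx.1, hx.2]
    have := hv x hx
    refine ⟨by simp only [this.1, mul_zero], ?_, ?_⟩
    · exact (h1 _ _ hxU).trans this.2.1
    · exact (h1 _ _ hxU).trans this.2.2

/-! ### Integration over the moving domain -/

theorem isOpen_domain (k T : ℝ) : IsOpen (domain k T) :=
  (isOpen_lt continuous_const continuous_snd).inter
    ((isOpen_lt continuous_snd continuous_const).inter
      ((isOpen_lt continuous_const continuous_fst).inter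
        (isOpen_lt continuous_fst (by fun_prop))))

theorem measurableSet_domain (k T : ℝ) : MeasurableSet (domain k T) :=
  (isOpen_domain k T).measurableSet

theorem domain_subset_box {k T : ℝ} (hk : 0 < k) :
    domain k T ⊆ Icc (0 : ℝ) (1 + k * T) ×ˢ Icc (0 : ℝ) T := by
  intro z hz
  refine ⟨⟨hz.2.2.1.le, ?_⟩, hz.1.le, hz.2.1.le⟩
  nlinarith [hz.1, hz.2.1, hz.2.2.1, hz.2.2.2]

theorem integrableOn_domain {k T : ℝ} (hk : 0 < k) {F : ℝ × ℝ → ℝ} (hF : Continuous F) :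
    IntegrableOn F (domain k T) :=
  (hF.continuousOn.integrableOn_compact (isCompact_Icc.prod isCompact_Icc)).mono_set
    (domain_subset_box hk)

theorem integral_domain_eq_time {k T : ℝ} (hk : 0 < k) {F : ℝ × ℝ → ℝ} (hF : Continuous F) :
    ∫ z in domain k T, F z = ∫ t in Ioo 0 T, ∫ x in Ioo 0 (1 + k * t), F (x, t) := by
  have hint := (integrable_indicator_iff (measurableSet_domain k T)).2
    (integrableOn_domain (T := T) hk hF)
  rw [← integral_indicator (measurableSet_domain k T)]
  rw [Measure.volume_eq_prod] at hint ⊢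
  rw [integral_prod_symm _ hint, ← integral_indicator measurableSet_Ioo]
  congr 1
  funext t
  by_cases ht : t ∈ Ioo 0 T
  · rw [indicator_of_mem ht, ← integral_indicator measurableSet_Ioo]
    congr 1
    funext x
    have : (x, t) ∈ domain k T ↔ x ∈ Ioo 0 (1 + k * t) :=
      ⟨fun h => h.2.2, fun h => ⟨ht.1, ht.2, h⟩⟩
    by_cases hx : x ∈ Ioo 0 (1 + k * t)
    · rw [indicator_of_mem hx, indicator_of_mem (this.2 hx)]
    · rw [indicator_of_notMem hx, indicator_of_notMem (mt this.1 hx)]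
  · rw [indicator_of_notMem ht]
    refine integral_eq_zero_of_ae (Filter.Eventually.of_forall fun x => ?_)
    exact indicator_of_notMem (fun h => ht ⟨h.1, h.2.1⟩) _

theorem integral_domain_eq_space {k T : ℝ} (hk : 0 < k) {F : ℝ × ℝ → ℝ} (hF : Continuous F) :
    ∫ z in domain k T, F z =
      ∫ x in Ioo 0 (1 + k * T), ∫ t in Ioo (max 0 ((x - 1) / k)) T, F (x, t) := by
  have hint := (integrable_indicator_iff (measurableSet_domain k T)).2
    (integrableOn_domain (T := T) hk hF)
  rw [← integral_indicator (measurableSet_domain k T)]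
  rw [Measure.volume_eq_prod] at hint ⊢
  rw [integral_prod _ hint, ← integral_indicator measurableSet_Ioo]
  congr 1
  funext x
  by_cases hx : x ∈ Ioo 0 (1 + k * T)
  · rw [indicator_of_mem hx, ← integral_indicator measurableSet_Ioo]
    congr 1
    funext t
    have : (x, t) ∈ domain k T ↔ t ∈ Ioo (max 0 ((x - 1) / k)) T := by
      simp only [domain, mem_ofPred_eq, mem_Ioo, max_lt_iff, div_lt_iff₀ hk]
      constructor
      · rintro ⟨h1, h2, h3, h4⟩
        exact ⟨⟨h1, by linarith⟩, h2⟩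
      · rintro ⟨⟨h1, h2⟩, h3⟩
        exact ⟨h1, h3, hx.1, by linarith⟩
    by_cases ht : t ∈ Ioo (max 0 ((x - 1) / k)) T
    · rw [indicator_of_mem ht, indicator_of_mem (this.2 ht)]
    · rw [indicator_of_notMem ht, indicator_of_notMem (mt this.1 ht)]
  · rw [indicator_of_notMem hx]
    refine integral_eq_zero_of_ae (Filter.Eventually.of_forall fun t => ?_)
    refine indicator_of_notMem (fun h => hx ⟨h.2.2.1, ?_⟩) _
    exact h.2.2.2.trans (by simp only; nlinarith [h.2.1])

theorem integral_dx {k T : ℝ} (hk : 0 < k) (hT : 0 < T) {A : ℝ × ℝ → ℝ} (hA : ContDiff ℝ ∞ A) :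
    ∫ z in domain k T, dx A z = ∫ t in (0)..T, (A (1 + k * t, t) - A (0, t)) := by
  rw [integral_domain_eq_time hk (contDiff_dx hA).continuous,
    intervalIntegral.integral_of_le hT.le, integral_Ioc_eq_integral_Ioo]
  refine setIntegral_congr_fun measurableSet_Ioo fun t ht => ?_
  have h1 : 0 ≤ 1 + k * t := by nlinarith [ht.1]
  rw [← integral_Ioc_eq_integral_Ioo, ← intervalIntegral.integral_of_le h1]
  exact intervalIntegral.integral_eq_sub_of_hasDerivAt (fun x _ => hasDerivAt_dx hA x t)
    (((contDiff_dx hA).continuous.comp (by fun_prop : Continuous fun x : ℝ => (x, t))).intervalIntegrable _ _)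

theorem integral_dt {k T : ℝ} (hk : 0 < k) (hT : 0 < T) {B : ℝ × ℝ → ℝ} (hB : ContDiff ℝ ∞ B) :
    ∫ z in domain k T, dt B z = (∫ x in (0)..(1 + k * T), B (x, T)) - (∫ x in (0)..1, B (x, 0)) -
      k * ∫ t in (0)..T, B (1 + k * t, t) := by
  have hkT : 0 < k * T := mul_pos hk hT
  -- The time at which the position x enters the domain: 0 for x ≤ 1, afterwards the arrival time of
  -- the moving end. Substituting x = 1 + k t on the second part produces the factor `k`.
  set m : ℝ → ℝ := fun x => max 0 ((x - 1) / k) with hm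
  have hmc : Continuous m := by fun_prop
  have hBc := hB.continuous
  have h1 : ∫ z in domain k T, dt B z = ∫ x in (0)..(1 + k * T), (B (x, T) - B (x, m x)) := by
    rw [integral_domain_eq_space hk (contDiff_dt hB).continuous,
      intervalIntegral.integral_of_le (by linarith), integral_Ioc_eq_integral_Ioo]
    refine setIntegral_congr_fun measurableSet_Ioo fun x hx => ?_
    have h1 : m x ≤ T := max_le hT.le (by rw [div_le_iff₀ hk]; linarith [hx.2])
    rw [← integral_Ioc_eq_integral_Ioo, ← intervalIntegral.integral_of_le h1]
    exact intervalIntegral.integral_eq_sub_of_hasDerivAt (fun t _ => hasDerivAt_dt hB x t)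
      (((contDiff_dt hB).continuous.comp (by fun_prop : Continuous fun t : ℝ => (x, t))).intervalIntegrable _ _)
  have hc : Continuous fun x => B (x, m x) := by fun_prop
  have h2 : ∫ x in (0)..1, B (x, m x) = ∫ x in (0)..1, B (x, 0) := by
    refine intervalIntegral.integral_congr fun x hx => ?_
    rw [uIcc_of_le zero_le_one] at hx
    have : m x = 0 := max_eq_left (div_nonpos_of_nonpos_of_nonneg (by linarith [hx.2]) hk.le)
    simp only [this]
  have h3 : ∫ x in (1)..(1 + k * T), B (x, m x) = k * ∫ t in (0)..T, B (1 + k * t, t) := by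
    have h4 := intervalIntegral.mul_integral_comp_add_mul (a := 0) (b := T) (f := fun x => B (x, m x)) k 1
    rw [mul_zero, add_zero] at h4
    rw [← h4]
    congr 1
    refine intervalIntegral.integral_congr fun t ht => ?_
    rw [uIcc_of_le hT.le] at ht
    have : m (1 + k * t) = t := by
      simp only [hm]
      rw [add_sub_cancel_left, mul_div_cancel_left₀ _ hk.ne', max_eq_right ht.1]
    simp only [this]
  rw [h1, intervalIntegral.integral_sub ((by fun_prop : Continuous fun x => B (x, T)).intervalIntegrable _ _)
    (hc.intervalIntegrable _ _), ← intervalIntegral.integral_add_adjacent_intervals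
      (hc.intervalIntegrable 0 1) (hc.intervalIntegrable 1 (1 + k * T)), h2, h3]
  ring

theorem dx_mul {φ ψ : ℝ × ℝ → ℝ} (hφ : ContDiff ℝ ∞ φ) (hψ : ContDiff ℝ ∞ ψ) (z : ℝ × ℝ) :
    dx (fun z => φ z * ψ z) z = dx φ z * ψ z + φ z * dx ψ z :=
  (hasDerivAt_dx (hφ.mul hψ) z.1 z.2).unique
    ((hasDerivAt_dx hφ z.1 z.2).mul (hasDerivAt_dx hψ z.1 z.2))

theorem dt_mul {φ ψ : ℝ × ℝ → ℝ} (hφ : ContDiff ℝ ∞ φ) (hψ : ContDiff ℝ ∞ ψ) (z : ℝ × ℝ) :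
    dt (fun z => φ z * ψ z) z = dt φ z * ψ z + φ z * dt ψ z :=
  (hasDerivAt_dt (hφ.mul hψ) z.1 z.2).unique
    ((hasDerivAt_dt hφ z.1 z.2).mul (hasDerivAt_dt hψ z.1 z.2))

/-! ### Green's formula and the energy estimate -/

/-- A smooth function that vanishes on the lateral boundary, and to first order at time `T`. -/
structure IsSmoothBackward (k T : ℝ) (p : ℝ × ℝ → ℝ) : Prop where
  smooth : ContDiff ℝ ∞ p
  left : ∀ t ∈ Icc 0 T, p (0, t) = 0
  right : ∀ t ∈ Icc 0 T, p (1 + k * t, t) = 0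
  final : ∀ x ∈ Icc 0 (1 + k * T), p (x, T) = 0 ∧ dx p (x, T) = 0 ∧ dt p (x, T) = 0

theorem integral_dx_of_eq {k T : ℝ} (hk : 0 < k) (hT : 0 < T) {A : ℝ × ℝ → ℝ}
    (hA : ContDiff ℝ ∞ A) (h : ∀ t ∈ Icc 0 T, A (1 + k * t, t) = 0) :
    ∫ z in domain k T, dx A z = - ∫ t in (0)..T, A (0, t) := by
  rw [integral_dx hk hT hA, ← intervalIntegral.integral_neg]
  refine intervalIntegral.integral_congr fun t ht => ?_
  rw [uIcc_of_le hT.le] at ht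
  simp [h t ht]

theorem interval_integral_eq_zero {a b : ℝ} (hab : a ≤ b) {f : ℝ → ℝ} (h : ∀ x ∈ Icc a b, f x = 0) :
    ∫ x in a..b, f x = 0 := by
  rw [intervalIntegral.integral_congr (g := fun _ => 0), intervalIntegral.integral_zero]
  intro x hx
  rw [uIcc_of_le hab] at hx
  exact h x hx

theorem integral_dt_eq_zero {k T : ℝ} (hk : 0 < k) (hT : 0 < T) {B : ℝ × ℝ → ℝ}
    (hB : ContDiff ℝ ∞ B) (h : ∀ t ∈ Icc 0 T, B (1 + k * t, t) = 0)
    (h0 : ∀ x ∈ Icc (0 : ℝ) 1, B (x, 0) = 0) (h1 : ∀ x ∈ Icc 0 (1 + k * T), B (x, T) = 0) :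
    ∫ z in domain k T, dt B z = 0 := by
  rw [integral_dt hk hT hB, interval_integral_eq_zero hT.le h,
    interval_integral_eq_zero zero_le_one h0,
    interval_integral_eq_zero (by nlinarith) h1]
  simp

theorem integral_domain_add {k T : ℝ} (hk : 0 < k) {F G : ℝ × ℝ → ℝ} (hF : Continuous F)
    (hG : Continuous G) : ∫ z in domain k T, (F z + G z) =
      (∫ z in domain k T, F z) + ∫ z in domain k T, G z :=
  integral_add (integrableOn_domain hk hF) (integrableOn_domain hk hG)

theorem IsSmoothBackward.integral_mul_dx {k T : ℝ} (hk : 0 < k) (hT : 0 < T) {p φ : ℝ × ℝ → ℝ}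
    (hp : IsSmoothBackward k T p) (hφ : ContDiff ℝ ∞ φ) :
    ∫ z in domain k T, p z * dx φ z = - ∫ z in domain k T, dx p z * φ z := by
  have h := integral_dx_of_eq hk hT (hp.smooth.mul hφ) fun t ht => by
    simp only [hp.right t ht, zero_mul]
  rw [interval_integral_eq_zero hT.le fun t ht => by simp only [hp.left t ht, zero_mul]] at h
  simp only [dx_mul hp.smooth hφ] at h
  rw [integral_domain_add (F := fun z => dx p z * φ z) (G := fun z => p z * dx φ z) hk
    ((contDiff_dx hp.smooth).continuous.mul hφ.continuous)
    (hp.smooth.continuous.mul (contDiff_dx hφ).continuous)] at h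
  linarith

theorem IsSmoothBackward.integral_mul_dt {k T : ℝ} (hk : 0 < k) (hT : 0 < T) {p φ : ℝ × ℝ → ℝ}
    (hp : IsSmoothBackward k T p) (hφ : ContDiff ℝ ∞ φ) (h0 : ∀ x ∈ Icc (0 : ℝ) 1, φ (x, 0) = 0) :
    ∫ z in domain k T, p z * dt φ z = - ∫ z in domain k T, dt p z * φ z := by
  have h := integral_dt_eq_zero hk hT (hp.smooth.mul hφ)
    (fun t ht => by simp only [hp.right t ht, zero_mul])
    (fun x hx => by simp only [h0 x hx, mul_zero])
    (fun x hx => by simp only [(hp.final x hx).1, zero_mul])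
  simp only [dt_mul hp.smooth hφ] at h
  rw [integral_domain_add (F := fun z => dt p z * φ z) (G := fun z => p z * dt φ z) hk
    ((contDiff_dt hp.smooth).continuous.mul hφ.continuous)
    (hp.smooth.continuous.mul (contDiff_dt hφ).continuous)] at h
  linarith

/-- Green's formula. -/
theorem IsSmoothBackward.green {k T : ℝ} (hk : 0 < k) (hT : 0 < T) {p φ : ℝ × ℝ → ℝ}
    (hp : IsSmoothBackward k T p) (hφ : ContDiff ℝ ∞ φ) (h0 : ∀ x ∈ Icc (0 : ℝ) 1, φ (x, 0) = 0)
    (hr : ∀ t ∈ Icc 0 T, φ (1 + k * t, t) = 0) :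
    (∫ z in domain k T, (- (dt p z * dt φ z) + dx p z * dx φ z)) =
      (∫ z in domain k T, (dt (dt p) z - dx (dx p) z) * φ z) -
        ∫ t in Ioo 0 T, dx p (0, t) * φ (0, t) := by
  have hx := contDiff_dx hp.smooth
  have ht := contDiff_dt hp.smooth
  have h := integral_dt_eq_zero hk hT (ht.mul hφ)
    (fun t ht => by simp only [hr t ht, mul_zero])
    (fun x hx => by simp only [h0 x hx, mul_zero])
    (fun x hx => by simp only [(hp.final x hx).2.2, zero_mul])
  have h' := integral_dx_of_eq hk hT (hx.mul hφ) fun t ht => by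
    simp only [hr t ht, mul_zero]
  rw [intervalIntegral.integral_of_le hT.le, integral_Ioc_eq_integral_Ioo] at h'
  have i1 : Integrable (fun z => dt (dt p) z * φ z) (volume.restrict (domain k T)) :=
    integrableOn_domain hk ((contDiff_dt ht).continuous.mul hφ.continuous)
  have i2 : Integrable (fun z => dt p z * dt φ z) (volume.restrict (domain k T)) :=
    integrableOn_domain hk (ht.continuous.mul (contDiff_dt hφ).continuous)
  have i3 : Integrable (fun z => dx (dx p) z * φ z) (volume.restrict (domain k T)) :=
    integrableOn_domain hk ((contDiff_dx hx).continuous.mul hφ.continuous)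
  have i4 : Integrable (fun z => dx p z * dx φ z) (volume.restrict (domain k T)) :=
    integrableOn_domain hk (hx.continuous.mul (contDiff_dx hφ).continuous)
  simp only [dt_mul ht hφ] at h
  simp only [dx_mul hx hφ] at h'
  rw [integral_add i1 i2] at h
  rw [integral_add i3 i4] at h'
  have i2' : Integrable (fun z => -(dt p z * dt φ z)) (volume.restrict (domain k T)) := i2.neg
  rw [integral_add i2' i4, integral_neg]
  simp only [sub_mul]
  rw [integral_sub i1 i3]
  linarith

/-- A Poincaré inequality: the integral of ∂_x(x p²) = p² + 2 x p p_x is zero by the lateral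
conditions, and (p + 2 x p_x)² ≥ 0 absorbs the cross term. -/
theorem IsSmoothBackward.integral_sq_le {k T : ℝ} (hk : 0 < k) (hT : 0 < T) {p : ℝ × ℝ → ℝ}
    (hp : IsSmoothBackward k T p) :
    ∫ z in domain k T, p z ^ 2 ≤ 4 * (1 + k * T) ^ 2 * ∫ z in domain k T, dx p z ^ 2 := by
  have hx := contDiff_dx hp.smooth
  have hpc := hp.smooth.continuous
  have hxc := hx.continuous
  have h := integral_dx_of_eq hk hT (contDiff_fst.mul (hp.smooth.mul hp.smooth))
    fun t ht => by simp only [hp.right t ht, mul_zero]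
  rw [interval_integral_eq_zero hT.le fun t ht => by simp only [hp.left t ht, mul_zero], neg_zero] at h
  have e : ∀ z, dx (fun z : ℝ × ℝ => z.1 * (p z * p z)) z = p z ^ 2 + 2 * (z.1 * (p z * dx p z)) := by
    intro z
    have h1 : dx (fun z : ℝ × ℝ => z.1) z = 1 :=
      (hasDerivAt_dx contDiff_fst z.1 z.2).unique (hasDerivAt_id _)
    rw [dx_mul contDiff_fst (hp.smooth.mul hp.smooth), dx_mul hp.smooth hp.smooth, h1]
    ring
  simp only [e] at h
  have i1 := integrableOn_domain (T := T) hk (F := fun z => p z ^ 2) (by fun_prop)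
  have i2 := integrableOn_domain (T := T) hk (F := fun z => dx p z ^ 2) (by fun_prop)
  have i3 := integrableOn_domain (T := T) hk (F := fun z => p z ^ 2 + 2 * (z.1 * (p z * dx p z))) (by fun_prop)
  have key : ∫ z in domain k T, (p z ^ 2 / 2 - 2 * (1 + k * T) ^ 2 * dx p z ^ 2) ≤
      ∫ z in domain k T, (p z ^ 2 + 2 * (z.1 * (p z * dx p z))) := by
    refine setIntegral_mono_on ((i1.div_const 2).sub (i2.const_mul _)) i3 (measurableSet_domain k T)
      fun z hz => ?_
    have hz' := (domain_subset_box hk hz).1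
    have h2 : (z.1 * dx p z) ^ 2 ≤ (1 + k * T) ^ 2 * dx p z ^ 2 := by
      rw [mul_pow]
      gcongr
      · exact hz'.1
      · exact hz'.2
    nlinarith [sq_nonneg (p z + 2 * (z.1 * dx p z))]
  rw [h, integral_sub (i1.div_const 2) (i2.const_mul _), integral_div, integral_const_mul] at key
  linarith

/-- The difference of the two sides is half of k x (p + q)² + k (1 + k t - x)(p - q)². For k < 1
this makes the energy density of the multiplier coercive. -/
theorem multiplier_energy_ge {k x t : ℝ} (hk : 0 < k) (hx0 : 0 ≤ x) (hx1 : x ≤ 1 + k * t)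
    (p q : ℝ) : (1 + k * t) * (1 - k) * (p ^ 2 + q ^ 2) / 2 ≤
      (1 + k * t) * (p ^ 2 + q ^ 2) / 2 + k * (2 * x - 1 - k * t) * (p * q) := by
  nlinarith [mul_nonneg (mul_nonneg hk.le hx0) (sq_nonneg (p + q)),
    mul_nonneg (mul_nonneg hk.le (sub_nonneg.2 hx1)) (sq_nonneg (p - q))]

/-- Write S = p² + q² and α = 1 + k t ≥ 1. The exponential weight contributes at least (5/2) α S.
The source term costs at most α f² + α S/2 and the derivatives of the multiplier at most S, so at
least S survives; the number 5 is chosen for this. -/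
theorem multiplier_bulk_ge {k x t r e a E : ℝ} (hk : 0 < k) (hk1 : k < 1) (hx0 : 0 ≤ x)
    (hx1 : x ≤ 1 + k * t) (a1 : 1 ≤ 1 + k * t) (a2 : 1 + k * t ≤ a) (e1 : 1 ≤ e) (e2 : e ≤ E)
    (hrk : r * (1 - k) = 5) (p q f : ℝ) :
    p ^ 2 + q ^ 2 - E * a * f ^ 2 ≤
      e * (r * ((1 + k * t) * (p ^ 2 + q ^ 2) / 2 + k * (2 * x - 1 - k * t) * (p * q)) +
        f * ((1 + k * t) * p + k * (2 * x - 1 - k * t) * q) - k * (p ^ 2 + q ^ 2) / 2 -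
        k ^ 2 * (p * q)) := by
  have hq := multiplier_energy_ge hk hx0 hx1 p q
  have hr0 : 0 ≤ r := by
    by_contra h
    nlinarith
  have s1 : r * ((1 + k * t) * (1 - k) * (p ^ 2 + q ^ 2) / 2) =
      5 / 2 * ((1 + k * t) * (p ^ 2 + q ^ 2)) := by
    linear_combination ((1 + k * t) * (p ^ 2 + q ^ 2) / 2) * hrk
  have s2 := mul_le_mul_of_nonneg_left hq hr0
  rw [s1] at s2
  have s3 : -((1 + k * t) * (f ^ 2 + (p ^ 2 + q ^ 2) / 2)) ≤
      f * ((1 + k * t) * p + k * (2 * x - 1 - k * t) * q) := by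
    have w1 : |k * (2 * x - 1 - k * t)| ≤ 1 + k * t := by
      rw [abs_le]
      constructor <;> nlinarith
    have w2 : -((1 + k * t) * ((f ^ 2 + q ^ 2) / 2)) ≤ f * (k * (2 * x - 1 - k * t) * q) := by
      have w3 : |f * q| ≤ (f ^ 2 + q ^ 2) / 2 := by
        rw [abs_le]
        constructor <;> nlinarith [sq_nonneg (f + q), sq_nonneg (f - q)]
      have w4 : |k * (2 * x - 1 - k * t) * (f * q)| ≤ (1 + k * t) * ((f ^ 2 + q ^ 2) / 2) := by
        rw [abs_mul]
        exact mul_le_mul w1 w3 (abs_nonneg _) (by linarith)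
      have := neg_abs_le (k * (2 * x - 1 - k * t) * (f * q))
      linarith
    have w5 : -((1 + k * t) * ((f ^ 2 + p ^ 2) / 2)) ≤ f * ((1 + k * t) * p) := by
      have := mul_nonneg (by linarith : 0 ≤ 1 + k * t) (sq_nonneg (f + p))
      linarith
    linarith
  have s4 : k * (p ^ 2 + q ^ 2) / 2 + k ^ 2 * (p * q) ≤ p ^ 2 + q ^ 2 := by
    have h1 : k ^ 2 ≤ 1 := by nlinarith
    have h2 := mul_nonneg (sq_nonneg k) (sq_nonneg (p - q))
    have h3 : 0 ≤ p ^ 2 + q ^ 2 := by positivity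
    have h4 := mul_le_mul_of_nonneg_right h1 h3
    have h5 := mul_le_mul_of_nonneg_right hk1.le h3
    linarith
  have s5 : (p ^ 2 + q ^ 2) - (1 + k * t) * f ^ 2 ≤
      r * ((1 + k * t) * (p ^ 2 + q ^ 2) / 2 + k * (2 * x - 1 - k * t) * (p * q)) +
      f * ((1 + k * t) * p + k * (2 * x - 1 - k * t) * q) - k * (p ^ 2 + q ^ 2) / 2 -
      k ^ 2 * (p * q) := by
    have := mul_nonneg (sub_nonneg.2 a1) (add_nonneg (sq_nonneg p) (sq_nonneg q))
    linarith
  refine le_trans ?_ (mul_le_mul_of_nonneg_left s5 (zero_le_one.trans e1))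
  have s7 : e * (1 + k * t) * f ^ 2 ≤ E * a * f ^ 2 := by
    gcongr
    exact zero_le_one.trans (e1.trans e2)
  have := mul_nonneg (sub_nonneg.2 e1) (add_nonneg (sq_nonneg p) (sq_nonneg q))
  linarith

/-- The energy estimate, together with the hidden regularity of the normal derivative at the fixed
end.  The multiplier `a p_t + b p_x` is timelike, tangent to the moving end, and points out of
the domain at the fixed end. -/
theorem IsSmoothBackward.energy_le {k T : ℝ} (hk : 0 < k) (hk1 : k < 1) (hT : 0 < T)
    {p : ℝ × ℝ → ℝ} (hp : IsSmoothBackward k T p) :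
    (∫ z in domain k T, (dx p z ^ 2 + dt p z ^ 2)) + k / 2 * ∫ t in Ioo 0 T, dx p (0, t) ^ 2 ≤
      Real.exp (5 / (1 - k) * T) * (1 + k * T) *
        ∫ z in domain k T, (dt (dt p) z - dx (dx p) z) ^ 2 := by
  have hkT : 0 < k * T := mul_pos hk hT
  have h1k : 0 < 1 - k := by linarith
  set r := 5 / (1 - k) with hr
  have hr0 : 0 < r := by positivity
  have hrk : r * (1 - k) = 5 := div_mul_cancel₀ _ h1k.ne'
  set R := dx p with hR
  set P := dt p with hP
  have hRs : ContDiff ℝ ∞ R := contDiff_dx hp.smooth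
  have hPs : ContDiff ℝ ∞ P := contDiff_dt hp.smooth
  have hRc := hRs.continuous
  have hPc := hPs.continuous
  have hRxc := (contDiff_dx hRs).continuous
  have hPtc := (contDiff_dt hPs).continuous
  -- `A` and `B` are the space and time fluxes for the multiplier a p_t + b p_x with a = 1 + k t and
  -- b = k(2x - 1 - k t), weighted by exp(r t). Here b = k a at the moving end and b = -k a at x =
  -- 0. In ∂_x A + ∂_t B the second derivatives of p combine into the source.
  set A : ℝ × ℝ → ℝ := fun z => -(Real.exp (r * z.2) * ((1 + k * z.2) * (P z * R z) +
    k * (2 * z.1 - 1 - k * z.2) * (P z ^ 2 + R z ^ 2) / 2)) with hA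
  set B : ℝ × ℝ → ℝ := fun z => Real.exp (r * z.2) * ((1 + k * z.2) * (P z ^ 2 + R z ^ 2) / 2 +
    k * (2 * z.1 - 1 - k * z.2) * (P z * R z)) with hB
  have hAs : ContDiff ℝ ∞ A := by
    simp only [hA]
    fun_prop
  have hBs : ContDiff ℝ ∞ B := by
    simp only [hB]
    fun_prop
  have hPR : ∀ z, dt R z = dx P z := dt_dx_comm hp.smooth
  have hdx : ∀ x t, dx A (x, t) = -(Real.exp (r * t) * ((1 + k * t) *
      (dx P (x, t) * R (x, t) + P (x, t) * dx R (x, t)) + k * (P (x, t) ^ 2 + R (x, t) ^ 2) +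
      k * (2 * x - 1 - k * t) * (P (x, t) * dx P (x, t) + R (x, t) * dx R (x, t)))) := by
    intro x t
    refine (hasDerivAt_dx hAs x t).unique ?_
    have d1 := hasDerivAt_dx hPs x t
    have d2 := hasDerivAt_dx hRs x t
    have d3 : HasDerivAt (fun x : ℝ => k * (2 * x - 1 - k * t)) (k * 2) x := by
      simpa using ((((hasDerivAt_id x).const_mul 2).sub_const 1).sub_const (k * t)).const_mul k
    refine (((((d1.mul d2).const_mul (1 + k * t)).add
      ((d3.mul ((d1.pow 2).add (d2.pow 2))).div_const 2)).const_mul (Real.exp (r * t))).neg).congr_deriv ?_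
    simp only [Pi.add_apply, Pi.pow_apply]
    push_cast
    ring
  have hdt : ∀ x t, dt B (x, t) = Real.exp (r * t) *
      (r * ((1 + k * t) * (P (x, t) ^ 2 + R (x, t) ^ 2) / 2 +
        k * (2 * x - 1 - k * t) * (P (x, t) * R (x, t))) +
      k * (P (x, t) ^ 2 + R (x, t) ^ 2) / 2 +
      (1 + k * t) * (P (x, t) * dt P (x, t) + R (x, t) * dt R (x, t)) -
      k ^ 2 * (P (x, t) * R (x, t)) +
      k * (2 * x - 1 - k * t) * (dt P (x, t) * R (x, t) + P (x, t) * dt R (x, t))) := by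
    intro x t
    refine (hasDerivAt_dt hBs x t).unique ?_
    have d1 := hasDerivAt_dt hPs x t
    have d2 := hasDerivAt_dt hRs x t
    have d3 : HasDerivAt (fun t : ℝ => k * (2 * x - 1 - k * t)) (k * (- k)) t := by
      simpa using (((hasDerivAt_id t).const_mul k).const_sub (2 * x - 1)).const_mul k
    have d4 : HasDerivAt (fun t : ℝ => 1 + k * t) k t := by
      simpa using ((hasDerivAt_id t).const_mul k).const_add 1
    have d5 : HasDerivAt (fun t : ℝ => Real.exp (r * t)) (Real.exp (r * t) * r) t := by
      simpa using ((hasDerivAt_id t).const_mul r).exp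
    refine (d5.mul (((d4.mul ((d1.pow 2).add (d2.pow 2))).div_const 2).add
      (d3.mul (d1.mul d2)))).congr_deriv ?_
    simp only [Pi.add_apply, Pi.pow_apply, Pi.mul_apply]
    push_cast
    ring
  have hbox : ∀ z ∈ domain k T, 1 ≤ Real.exp (r * z.2) ∧ Real.exp (r * z.2) ≤ Real.exp (r * T) ∧
      1 ≤ 1 + k * z.2 ∧ 1 + k * z.2 ≤ 1 + k * T := by
    intro z hz
    have h1 := hz.1
    have h2 := hz.2.1
    refine ⟨Real.one_le_exp (by positivity), Real.exp_le_exp.2 (by gcongr), ?_, by gcongr⟩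
    have := mul_pos hk h1
    linarith
  have ib : Integrable (fun z => P z ^ 2 + R z ^ 2) (volume.restrict (domain k T)) :=
    integrableOn_domain hk (by fun_prop)
  have ic : Integrable (fun z => (dt P z - dx R z) ^ 2) (volume.restrict (domain k T)) :=
    integrableOn_domain hk (by fun_prop)
  have iA : Integrable (dx A) (volume.restrict (domain k T)) :=
    integrableOn_domain hk (contDiff_dx hAs).continuous
  have iB : Integrable (dt B) (volume.restrict (domain k T)) :=
    integrableOn_domain hk (contDiff_dt hBs).continuous
  have lower : ∫ z in domain k T, ((P z ^ 2 + R z ^ 2) -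
      Real.exp (r * T) * (1 + k * T) * (dt P z - dx R z) ^ 2) ≤
      ∫ z in domain k T, (dx A z + dt B z) := by
    refine setIntegral_mono_on (ib.sub (ic.const_mul _)) (iA.add iB) (measurableSet_domain k T) ?_
    rintro ⟨x, t⟩ hz
    obtain ⟨e1, e2, a1, a2⟩ := hbox _ hz
    have hx0 := hz.2.2.1.le
    have hx1 := hz.2.2.2.le
    simp only at e1 e2 a1 a2 hx0 hx1 ⊢
    rw [hdx, hdt, hPR]
    refine (multiplier_bulk_ge hk hk1 hx0 hx1 a1 a2 e1 e2 hrk (P (x, t)) (R (x, t))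
      (dt P (x, t) - dx R (x, t))).trans (le_of_eq ?_)
    ring
  have upper : ∫ z in domain k T, (dx A z + dt B z) ≤ -(k / 2 * ∫ t in Ioo 0 T, R (0, t) ^ 2) := by
    have hPl : ∀ t ∈ Ioo 0 T, P (0, t) = 0 := by
      intro t ht
      refine (hasDerivAt_dt hp.smooth 0 t).unique ?_
      refine (hasDerivAt_const t (0 : ℝ)).congr_of_eventuallyEq ?_
      exact Filter.eventually_of_mem (Ioo_mem_nhds ht.1 ht.2) fun s hs => hp.left s ⟨hs.1.le, hs.2.le⟩
    have hPr : ∀ t ∈ Ioo 0 T, P (1 + k * t, t) = -k * R (1 + k * t, t) := by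
      intro t ht
      have d4 : HasDerivAt (fun t : ℝ => 1 + k * t) k t := by
        simpa using ((hasDerivAt_id t).const_mul k).const_add 1
      have h1 := (hasDerivAt_line hp.smooth (d4.prodMk (hasDerivAt_id t))).unique
        ((hasDerivAt_const t (0 : ℝ)).congr_of_eventuallyEq
          (Filter.eventually_of_mem (Ioo_mem_nhds ht.1 ht.2) fun s hs =>
            hp.right s ⟨hs.1.le, hs.2.le⟩))
      rw [dirDeriv_eq] at h1
      simp only [id, ← hP, ← hR] at h1
      linarith
    have hfin : ∫ x in (0)..(1 + k * T), B (x, T) = 0 :=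
      interval_integral_eq_zero (by linarith) fun x hx => by
        obtain ⟨-, h2, h3⟩ := hp.final x hx
        rw [← hR] at h2
        rw [← hP] at h3
        simp only [hB, h2, h3]
        simp
    have hini : 0 ≤ ∫ x in (0)..1, B (x, 0) := by
      refine intervalIntegral.integral_nonneg zero_le_one fun x hx => ?_
      have hq := multiplier_energy_ge hk hx.1 (t := 0) (by linarith [hx.2]) (P (x, 0)) (R (x, 0))
      refine mul_nonneg (Real.exp_nonneg _) (le_trans ?_ hq)
      have := h1k.le
      positivity
    have hside : (∫ t in (0)..T, (A (1 + k * t, t) - A (0, t))) - k * ∫ t in (0)..T, B (1 + k * t, t) ≤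
        -(k / 2 * ∫ t in Ioo 0 T, R (0, t) ^ 2) := by
      have hAc := hAs.continuous
      have hBc := hBs.continuous
      rw [← intervalIntegral.integral_const_mul, ← intervalIntegral.integral_sub
        (Continuous.intervalIntegrable (by fun_prop) _ _)
        (Continuous.intervalIntegrable (by fun_prop) _ _),
        ← integral_const_mul, ← integral_neg, intervalIntegral.integral_of_le hT.le,
        integral_Ioc_eq_integral_Ioo]
      have cont : ∀ {F : ℝ → ℝ}, Continuous F → IntegrableOn F (Ioo 0 T) := fun hF =>
        (hF.continuousOn.integrableOn_compact (isCompact_Icc (a := 0) (b := T))).mono_set Ioo_subset_Icc_self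
      refine setIntegral_mono_on (cont (by fun_prop)) (cont (by fun_prop)) measurableSet_Ioo fun t ht => ?_
      have e1 : 1 ≤ Real.exp (r * t) := Real.one_le_exp (mul_pos hr0 ht.1).le
      have e2 : 0 ≤ k * t := (mul_pos hk ht.1).le
      simp only [hA, hB]
      rw [hPr t ht, hPl t ht]
      -- With p_t = -k p_x at the moving end, the flux through that end cancels exactly. Only x = 0
      -- contributes, with a favourable sign: this is the hidden regularity of the normal
      -- derivative.
      have id1 : ∀ e y x : ℝ, -(e * ((1 + k * t) * (-k * y * y) +
          k * (2 * (1 + k * t) - 1 - k * t) * ((-k * y) ^ 2 + y ^ 2) / 2)) -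
          -(e * ((1 + k * t) * (0 * x) + k * (2 * 0 - 1 - k * t) * (0 ^ 2 + x ^ 2) / 2)) -
          k * (e * ((1 + k * t) * ((-k * y) ^ 2 + y ^ 2) / 2 +
            k * (2 * (1 + k * t) - 1 - k * t) * (-k * y * y))) =
          -(k / 2 * (e * (1 + k * t) * x ^ 2)) := by
        intro e y x
        ring
      rw [id1]
      have : R (0, t) ^ 2 ≤ Real.exp (r * t) * (1 + k * t) * R (0, t) ^ 2 := by
        refine le_mul_of_one_le_left (sq_nonneg _) ?_
        nlinarith
      have := mul_le_mul_of_nonneg_left this (by positivity : 0 ≤ k / 2)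
      linarith
    rw [integral_add iA iB, integral_dx hk hT hAs, integral_dt hk hT hBs, hfin]
    linarith
  rw [integral_sub ib (ic.const_mul _), integral_const_mul] at lower
  have hsymm : ∫ z in domain k T, (R z ^ 2 + P z ^ 2) = ∫ z in domain k T, (P z ^ 2 + R z ^ 2) := by
    simp only [add_comm]
  rw [hsymm]
  linarith

/-! ### Weak formulations as continuous functionals -/

section Pairing

variable {α : Type*} [MeasurableSpace α] {μ : Measure α}

/-- Integration against a square integrable function. -/
def pairing {ψ : α → ℝ} (hψ : MemLp ψ 2 μ) : Lp ℝ 2 μ →L[ℝ] ℝ := innerSL ℝ (hψ.toLp ψ)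

theorem inner_eq_integral_mul (p q : Lp ℝ 2 μ) : inner ℝ p q = ∫ z, p z * q z ∂μ := by
  rw [L2.inner_def]
  refine integral_congr_ae (Filter.Eventually.of_forall fun z => ?_)
  simp [mul_comm]

theorem pairing_apply {ψ : α → ℝ} (hψ : MemLp ψ 2 μ) (p : Lp ℝ 2 μ) :
    pairing hψ p = ∫ z, p z * ψ z ∂μ := by
  rw [pairing, innerSL_apply_apply, real_inner_comm, inner_eq_integral_mul]
  refine integral_congr_ae ?_
  filter_upwards [hψ.coeFn_toLp] with z hz
  rw [hz]

theorem integrable_mul_of_memLp {ψ : α → ℝ} (hψ : MemLp ψ 2 μ) (p : Lp ℝ 2 μ) :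
    Integrable (fun z => p z * ψ z) μ :=
  (Lp.memLp p).integrable_mul hψ

theorem norm_toLp_sq {ψ : α → ℝ} (hψ : MemLp ψ 2 μ) : ‖hψ.toLp ψ‖ ^ 2 = ∫ z, ψ z ^ 2 ∂μ := by
  rw [← real_inner_self_eq_norm_sq, inner_eq_integral_mul]
  refine integral_congr_ae ?_
  filter_upwards [hψ.coeFn_toLp] with z hz
  rw [hz, sq]

theorem norm_sq_eq_integral (p : Lp ℝ 2 μ) : ‖p‖ ^ 2 = ∫ z, p z ^ 2 ∂μ := by
  rw [← real_inner_self_eq_norm_sq, inner_eq_integral_mul]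
  simp only [sq]

end Pairing

theorem memLp_domain {k T : ℝ} (hk : 0 < k) {F : ℝ × ℝ → ℝ} (hF : Continuous F) :
    MemLp F 2 (volume.restrict (domain k T)) :=
  (memLp_two_iff_integrable_sq hF.aestronglyMeasurable).2 (integrableOn_domain hk (hF.pow 2))

theorem memLp_time {T : ℝ} {F : ℝ → ℝ} (hF : Continuous F) :
    MemLp F 2 (volume.restrict (Ioo 0 T)) :=
  (memLp_two_iff_integrable_sq hF.aestronglyMeasurable).2
    (((hF.pow 2).continuousOn.integrableOn_compact (isCompact_Icc (a := 0) (b := T))).mono_set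
      Ioo_subset_Icc_self)

instance isFiniteMeasure_domain {k T : ℝ} [hk : Fact (0 < k)] :
    IsFiniteMeasure (volume.restrict (domain k T)) :=
  ⟨by
    rw [Measure.restrict_apply_univ]
    exact (measure_mono (domain_subset_box hk.out)).trans_lt
      (isCompact_Icc.prod isCompact_Icc).measure_lt_top⟩

theorem Lp_eq_zero_of_integral_smooth {E : Type*} [NormedAddCommGroup E] [NormedSpace ℝ E]
    [FiniteDimensional ℝ E] [MeasurableSpace E] [BorelSpace E] {μ : Measure E} {U : Set E}
    (hU : IsOpen U) [IsFiniteMeasure (μ.restrict U)] (p : Lp ℝ 2 (μ.restrict U))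
    (h : ∀ g : E → ℝ, ContDiff ℝ ∞ g → HasCompactSupport g → tsupport g ⊆ U →
      ∫ z in U, p z * g z ∂μ = 0) : p = 0 := by
  have h1 : IntegrableOn p U μ := (Lp.memLp p).integrable (by norm_num)
  have h2 := hU.ae_eq_zero_of_integral_contDiff_smul_eq_zero (f := p) (μ := μ)
    h1.locallyIntegrableOn fun g hg hgc hgs => by
      rw [← h g hg hgc hgs]
      rw [← setIntegral_eq_integral_of_forall_compl_eq_zero (s := U)]
      · simp only [smul_eq_mul, mul_comm]
      · intro x hx
        rw [image_eq_zero_of_notMem_tsupport fun hx' => hx (hgs hx'), zero_smul]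
  rw [Lp.eq_zero_iff_ae_eq_zero]
  exact (ae_restrict_iff' hU.measurableSet).2 h2

theorem weakForm_eq {k T : ℝ} (hk : 0 < k) (px pt : L2Domain k T) {φ : ℝ × ℝ → ℝ}
    (hφ : ContDiff ℝ ∞ φ) :
    ∫ z in domain k T, (-(pt z * dt φ z) + px z * dx φ z) =
      -pairing (memLp_domain hk (contDiff_dt hφ).continuous) pt +
        pairing (memLp_domain hk (contDiff_dx hφ).continuous) px := by
  have i1 : Integrable (fun z => -(pt z * dt φ z)) (volume.restrict (domain k T)) :=
    (integrable_mul_of_memLp (memLp_domain hk (contDiff_dt hφ).continuous) pt).neg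
  rw [integral_add i1 (integrable_mul_of_memLp (memLp_domain hk (contDiff_dx hφ).continuous) px),
    integral_neg, pairing_apply, pairing_apply]

/-- As equations between continuous linear functionals, the weak identities visibly cut out a closed
subspace; the next two characterizations serve the same end. -/
theorem hasZeroTraceGradient_iff {k T : ℝ} (hk : 0 < k) {p px pt : L2Domain k T} :
    HasZeroTraceGradient k T p px pt ↔ ∀ (φ : ℝ × ℝ → ℝ) (hφ : ContDiff ℝ ∞ φ), HasCompactSupport φ →
      (∀ x ∈ Icc (0 : ℝ) 1, φ (x, 0) = 0) →
      pairing (memLp_domain hk (contDiff_dx hφ).continuous) p =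
        - pairing (memLp_domain hk hφ.continuous) px ∧
      pairing (memLp_domain hk (contDiff_dt hφ).continuous) p =
        - pairing (memLp_domain hk hφ.continuous) pt := by
  simp only [pairing_apply]
  rfl

theorem weakBackwardWave_iff {k T : ℝ} (hk : 0 < k) {f px pt : L2Domain k T} :
    WeakBackwardWave k T f px pt ↔ ∀ (φ : ℝ × ℝ → ℝ) (hφ : ContDiff ℝ ∞ φ), HasCompactSupport φ →
      (∀ x ∈ Icc (0 : ℝ) 1, φ (x, 0) = 0) →
      (∀ t ∈ Icc (0 : ℝ) T, φ (0, t) = 0 ∧ φ (1 + k * t, t) = 0) →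
      -pairing (memLp_domain hk (contDiff_dt hφ).continuous) pt +
        pairing (memLp_domain hk (contDiff_dx hφ).continuous) px =
        pairing (memLp_domain hk hφ.continuous) f := by
  refine forall_congr' fun φ => forall_congr' fun hφ => ?_
  rw [weakForm_eq hk _ _ hφ, pairing_apply (memLp_domain hk hφ.continuous)]

theorem continuous_boundary {φ : ℝ × ℝ → ℝ} (hφ : ContDiff ℝ ∞ φ) :
    Continuous fun t => φ (0, t) :=
  hφ.continuous.comp (by fun_prop)

theorem hasNormalTrace_iff {k T : ℝ} (hk : 0 < k) {f px pt : L2Domain k T} {q : L2Time (Ioo 0 T)} :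
    HasNormalTrace k T f px pt q ↔ ∀ (φ : ℝ × ℝ → ℝ) (hφ : ContDiff ℝ ∞ φ), HasCompactSupport φ →
      tsupport φ ⊆ {z | 0 < z.2 ∧ z.2 < T ∧ z.1 < 1 + k * z.2} →
      -pairing (memLp_domain hk (contDiff_dt hφ).continuous) pt +
        pairing (memLp_domain hk (contDiff_dx hφ).continuous) px =
        pairing (memLp_domain hk hφ.continuous) f -
          pairing (memLp_time (continuous_boundary hφ)) q := by
  refine forall_congr' fun φ => forall_congr' fun hφ => ?_
  rw [weakForm_eq hk _ _ hφ, pairing_apply (memLp_domain hk hφ.continuous),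
    pairing_apply (memLp_time (continuous_boundary hφ))]

/-! ### Well-posedness of the adjoint problem -/

/-- The quintuples `(f, (p, p_x, p_t, q))` of a source, the corresponding adjoint solution, its
gradient and its normal trace. -/
def adjointGraph (k T : ℝ) (hk : 0 < k) : Submodule ℝ
    (L2Domain k T × (L2Domain k T × L2Domain k T × L2Domain k T × L2Time (Ioo 0 T))) where
  carrier := {x | HasZeroTraceGradient k T x.2.1 x.2.2.1 x.2.2.2.1 ∧
    WeakBackwardWave k T x.1 x.2.2.1 x.2.2.2.1 ∧
    HasNormalTrace k T x.1 x.2.2.1 x.2.2.2.1 x.2.2.2.2}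
  add_mem' := by
    rintro ⟨f, p, px, pt, q⟩ ⟨f', p', px', pt', q'⟩ ⟨h1, h2, h3⟩ ⟨h1', h2', h3'⟩
    simp only [hasZeroTraceGradient_iff hk, weakBackwardWave_iff hk, hasNormalTrace_iff hk,
      Prod.mk_add_mk, map_add, mem_ofPred_eq] at *
    refine ⟨fun φ hφ hc h0 => ⟨?_, ?_⟩, fun φ hφ hc h0 hl => ?_, fun φ hφ hc hs => ?_⟩
    · linarith [h1 φ hφ hc h0, h1' φ hφ hc h0]
    · linarith [h1 φ hφ hc h0, h1' φ hφ hc h0]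
    · linarith [h2 φ hφ hc h0 hl, h2' φ hφ hc h0 hl]
    · linarith [h3 φ hφ hc hs, h3' φ hφ hc hs]
  zero_mem' := by
    simp [hasZeroTraceGradient_iff hk, weakBackwardWave_iff hk, hasNormalTrace_iff hk]
  smul_mem' := by
    rintro c ⟨f, p, px, pt, q⟩ ⟨h1, h2, h3⟩
    simp only [hasZeroTraceGradient_iff hk, weakBackwardWave_iff hk, hasNormalTrace_iff hk,
      Prod.smul_mk, map_smul, mem_ofPred_eq, smul_eq_mul] at *
    refine ⟨fun φ hφ hc h0 => ⟨?_, ?_⟩, fun φ hφ hc h0 hl => ?_, fun φ hφ hc hs => ?_⟩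
    · linear_combination c * (h1 φ hφ hc h0).1
    · linear_combination c * (h1 φ hφ hc h0).2
    · linear_combination c * h2 φ hφ hc h0 hl
    · linear_combination c * h3 φ hφ hc hs

theorem mem_adjointGraph {k T : ℝ} {hk : 0 < k} {f p px pt : L2Domain k T}
    {q : L2Time (Ioo 0 T)} : (f, (p, px, pt, q)) ∈ adjointGraph k T hk ↔
      HasZeroTraceGradient k T p px pt ∧ WeakBackwardWave k T f px pt ∧
        HasNormalTrace k T f px pt q := Iff.rfl

theorem isAdjointSolution_iff {k T : ℝ} (hk : 0 < k) {f p : L2Domain k T}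
    {q : L2Time (Ioo 0 T)} : IsAdjointSolution k T f p q ↔
      ∃ px pt, (f, (p, px, pt, q)) ∈ adjointGraph k T hk := Iff.rfl

theorem isClosed_adjointGraph (k T : ℝ) (hk : 0 < k) :
    IsClosed (adjointGraph k T hk : Set (L2Domain k T ×
      (L2Domain k T × L2Domain k T × L2Domain k T × L2Time (Ioo 0 T)))) := by
  have : (adjointGraph k T hk : Set (L2Domain k T ×
      (L2Domain k T × L2Domain k T × L2Domain k T × L2Time (Ioo 0 T)))) =
      {x | HasZeroTraceGradient k T x.2.1 x.2.2.1 x.2.2.2.1} ∩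
      ({x | WeakBackwardWave k T x.1 x.2.2.1 x.2.2.2.1} ∩
      {x | HasNormalTrace k T x.1 x.2.2.1 x.2.2.2.1 x.2.2.2.2}) := rfl
  rw [this]
  simp only [hasZeroTraceGradient_iff hk, weakBackwardWave_iff hk, hasNormalTrace_iff hk,
    ofPred_forall]
  refine IsClosed.inter ?_ (IsClosed.inter ?_ ?_)
  · refine isClosed_iInter fun φ => isClosed_iInter fun hφ => isClosed_iInter fun _ =>
      isClosed_iInter fun _ => ?_
    exact (isClosed_eq (by fun_prop) (by fun_prop)).inter (isClosed_eq (by fun_prop) (by fun_prop))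
  · refine isClosed_iInter fun φ => isClosed_iInter fun hφ => isClosed_iInter fun _ =>
      isClosed_iInter fun _ => isClosed_iInter fun _ => ?_
    exact isClosed_eq (by fun_prop) (by fun_prop)
  · refine isClosed_iInter fun φ => isClosed_iInter fun hφ => isClosed_iInter fun _ =>
      isClosed_iInter fun _ => ?_
    exact isClosed_eq (by fun_prop) (by fun_prop)

/-- Duality: for any test source g, take a smooth φ at rest at t = 0 with φ_tt - φ_xx = g. Using φ_x
and φ_t as test functions for the gradient, and φ for the equation, gives ∫ p g = 0. Once p = 0, its
gradient vanishes, and then Green's formula forces the trace to vanish. -/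
theorem adjointGraph_unique {k T : ℝ} (hk : 0 < k) (hk1 : k < 1) (hT : 0 < T)
    (y : L2Domain k T × L2Domain k T × L2Domain k T × L2Time (Ioo 0 T))
    (h : (0, y) ∈ adjointGraph k T hk) : y = 0 := by
  obtain ⟨p, px, pt, q⟩ := y
  have := Fact.mk hk
  obtain ⟨h1, h2, h3⟩ := mem_adjointGraph.1 h
  rw [hasZeroTraceGradient_iff hk] at h1
  rw [weakBackwardWave_iff hk] at h2
  rw [hasNormalTrace_iff hk] at h3
  have hp : p = 0 := by
    refine Lp_eq_zero_of_integral_smooth (isOpen_domain k T) p fun g hg hgc hgs => ?_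
    obtain ⟨φ, hφ, hφc, hw, hlat, hini⟩ := exists_smooth_forward hk hk1 hT hg hgc hgs
    have e1 := (h1 (dx φ) (contDiff_dx hφ) (hφc.fderiv_apply ℝ _)
      fun x hx => (hini x hx).2.1).1
    have e2 := (h1 (dt φ) (contDiff_dt hφ) (hφc.fderiv_apply ℝ _)
      fun x hx => (hini x hx).2.2).2
    have e3 := h2 φ hφ hφc (fun x hx => (hini x hx).1) hlat
    rw [map_zero] at e3
    have i1 := integrable_mul_of_memLp (memLp_domain hk (contDiff_dt (contDiff_dt hφ)).continuous) p
    have i2 := integrable_mul_of_memLp (memLp_domain hk (contDiff_dx (contDiff_dx hφ)).continuous) p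
    have e4 : ∫ z in domain k T, p z * g z =
        ∫ z in domain k T, (p z * dt (dt φ) z - p z * dx (dx φ) z) := by
      refine setIntegral_congr_fun (measurableSet_domain k T) fun z hz => ?_
      rw [← hw z hz, mul_sub]
    rw [e4, integral_sub i1 i2,
      ← pairing_apply (memLp_domain hk (contDiff_dt (contDiff_dt hφ)).continuous),
      ← pairing_apply (memLp_domain hk (contDiff_dx (contDiff_dx hφ)).continuous), e1, e2]
    linarith
  have hb : ∀ g : ℝ × ℝ → ℝ, tsupport g ⊆ domain k T → ∀ x ∈ Icc (0 : ℝ) 1, g (x, 0) = 0 :=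
    fun g hgs x _ => image_eq_zero_of_notMem_tsupport fun hz => lt_irrefl _ (hgs hz).1
  subst hp
  have hpx : px = 0 := by
    refine Lp_eq_zero_of_integral_smooth (isOpen_domain k T) px fun g hg hgc hgs => ?_
    have := (h1 g hg hgc (hb g hgs)).1
    rw [map_zero, pairing_apply] at this
    linarith
  have hpt : pt = 0 := by
    refine Lp_eq_zero_of_integral_smooth (isOpen_domain k T) pt fun g hg hgc hgs => ?_
    have := (h1 g hg hgc (hb g hgs)).2
    rw [map_zero, pairing_apply] at this
    linarith
  subst hpx hpt
  have hq : q = 0 := by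
    refine Lp_eq_zero_of_integral_smooth isOpen_Ioo q fun η hη hηc hηs => ?_
    -- The outer radius is below 1, hence the support stays to the left of the moving end; `χ 0 = 1`
    -- leaves the integral of `q` against `η`.
    let χ : ContDiffBump (0 : ℝ) := ⟨1 / 4, 1 / 2, by norm_num, by norm_num⟩
    have hsub : tsupport (fun z : ℝ × ℝ => χ z.1 * η z.2) ⊆ tsupport χ ×ˢ tsupport η := by
      refine closure_minimal (fun z hz => ?_) ((isClosed_tsupport _).prod (isClosed_tsupport _))
      have := mul_ne_zero_iff.1 hz
      exact ⟨subset_tsupport _ this.1, subset_tsupport _ this.2⟩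
    have hs := h3 (fun z => χ z.1 * η z.2) ((χ.contDiff.comp contDiff_fst).mul (hη.comp contDiff_snd))
      (HasCompactSupport.of_support_subset_isCompact
        (χ.hasCompactSupport.isCompact.prod hηc.isCompact) ((subset_tsupport _).trans hsub))
      (fun z hz => by
        have hz' := hsub hz
        have h4 := hηs hz'.2
        have h5 := hz'.1
        rw [χ.tsupport_eq, mem_closedBall_zero_iff, Real.norm_eq_abs] at h5
        refine ⟨h4.1, h4.2, ?_⟩
        have h6 : z.1 ≤ 1 / 2 := (le_abs_self _).trans h5
        have h7 := mul_pos hk h4.1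
        linarith)
    rw [map_zero, map_zero, map_zero, pairing_apply] at hs
    have hχ : χ 0 = 1 := χ.one_of_mem_closedBall (by simp [χ.rIn_pos.le])
    simp only [hχ, one_mul] at hs
    linarith
  rw [hq]
  rfl

/-- A closed linear relation that is single-valued, and solvable with a bound on a dense subspace,
is the graph of a bounded operator. -/
theorem exists_clm_of_closed_relation {X Y : Type*} [NormedAddCommGroup X] [NormedSpace ℝ X]
    [NormedAddCommGroup Y] [NormedSpace ℝ Y] [CompleteSpace Y] (Γ : Submodule ℝ (X × Y))
    (hΓ : IsClosed (Γ : Set (X × Y))) (huniq : ∀ y, (0, y) ∈ Γ → y = 0) (D : Submodule ℝ X)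
    (hD : Dense (D : Set X)) (C : ℝ) (hex : ∀ f ∈ D, ∃ y, (f, y) ∈ Γ ∧ ‖y‖ ≤ C * ‖f‖) :
    ∃ A : X →L[ℝ] Y, ∀ f y, (f, y) ∈ Γ ↔ y = A f := by
  have huniq' : ∀ {f y y'}, (f, y) ∈ Γ → (f, y') ∈ Γ → y = y' := by
    intro f y y' h h'
    have := huniq (y - y') (by simpa using Γ.sub_mem h h')
    exact sub_eq_zero.1 this
  choose a ha hab using fun f : D => hex f f.2
  let A₀ : D →ₗ[ℝ] Y :=
    { toFun := a
      map_add' := fun f g => huniq' (ha (f + g)) (by simpa using Γ.add_mem (ha f) (ha g))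
      map_smul' := fun c f => huniq' (ha (c • f)) (by simpa using Γ.smul_mem c (ha f)) }
  let A₁ : D →L[ℝ] Y := A₀.mkContinuous C hab
  have hdr : DenseRange D.subtypeL := by
    simpa [DenseRange] using hD
  have hext : ∀ f : D, A₁.extend D.subtypeL (f : X) = a f := fun f =>
    ContinuousLinearMap.extend_eq A₁ hdr isUniformEmbedding_subtype_val.isUniformInducing f
  -- The sources whose extended value lies in the relation form a closed set containing the dense
  -- subspace.
  have hmem : ∀ f, (f, A₁.extend D.subtypeL f) ∈ Γ := by
    intro f
    have hcl : IsClosed {f : X | (f, A₁.extend D.subtypeL f) ∈ Γ} :=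
      hΓ.preimage (continuous_id.prodMk (A₁.extend D.subtypeL).continuous)
    have hsub : closure (D : Set X) ⊆ {f : X | (f, A₁.extend D.subtypeL f) ∈ Γ} := by
      refine closure_minimal (fun f hf => ?_) hcl
      have := hext ⟨f, hf⟩
      simp only at this
      change (f, A₁.extend D.subtypeL f) ∈ Γ
      rw [this]
      exact ha ⟨f, hf⟩
    exact hsub (hD f)
  refine ⟨A₁.extend D.subtypeL, fun f y => ⟨fun h => huniq' h (hmem f), fun h => h ▸ hmem f⟩⟩

/-- The classes of the smooth functions with compact support in the domain. -/
def testFunctions (k T : ℝ) (hk : 0 < k) : Submodule ℝ (L2Domain k T) where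
  carrier := {f | ∃ (g : ℝ × ℝ → ℝ) (hg : ContDiff ℝ ∞ g), HasCompactSupport g ∧
    tsupport g ⊆ domain k T ∧ f = (memLp_domain hk hg.continuous).toLp g}
  add_mem' := by
    rintro _ _ ⟨g, hg, hgc, hgs, rfl⟩ ⟨g', hg', hgc', hgs', rfl⟩
    exact ⟨g + g', hg.add hg', hgc.add hgc', (tsupport_add g g').trans (union_subset hgs hgs'), rfl⟩
  zero_mem' := ⟨fun _ => 0, contDiff_const, HasCompactSupport.zero, by simp, rfl⟩
  smul_mem' := by
    rintro c _ ⟨g, hg, hgc, hgs, rfl⟩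
    refine ⟨c • g, contDiff_const.smul hg, hgc.smul_left (f := fun _ => c), ?_, rfl⟩
    exact (closure_mono (Function.support_const_smul_subset c g)).trans hgs

theorem dense_testFunctions {k T : ℝ} (hk : 0 < k) :
    Dense (testFunctions k T hk : Set (L2Domain k T)) := by
  have := Fact.mk hk
  rw [Submodule.dense_iff_topologicalClosure_eq_top, Submodule.topologicalClosure_eq_top_iff,
    Submodule.eq_bot_iff]
  intro f hf
  refine Lp_eq_zero_of_integral_smooth (isOpen_domain k T) f fun g hg hgc hgs => ?_
  rw [← pairing_apply (memLp_domain hk hg.continuous)]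
  exact (Submodule.mem_orthogonal _ _).1 hf _ ⟨g, hg, hgc, hgs, rfl⟩

theorem IsSmoothBackward.mem_adjointGraph {k T : ℝ} (hk : 0 < k) (hT : 0 < T) {p : ℝ × ℝ → ℝ}
    (hp : IsSmoothBackward k T p) {g : ℝ × ℝ → ℝ} (hg : ContDiff ℝ ∞ g)
    (hw : ∀ z, dt (dt p) z - dx (dx p) z = g z) :
    ((memLp_domain hk hg.continuous).toLp g, ((memLp_domain hk hp.smooth.continuous).toLp p,
      (memLp_domain hk (contDiff_dx hp.smooth).continuous).toLp (dx p),
      (memLp_domain hk (contDiff_dt hp.smooth).continuous).toLp (dt p),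
      (memLp_time (continuous_boundary (contDiff_dx hp.smooth))).toLp fun t => dx p (0, t))) ∈
      adjointGraph k T hk := by
  have hm : ∀ {F : ℝ × ℝ → ℝ} (hF : Continuous F) (ψ : ℝ × ℝ → ℝ),
      ∫ z in domain k T, (memLp_domain (T := T) hk hF).toLp F z * ψ z =
        ∫ z in domain k T, F z * ψ z := fun hF ψ => by
    refine integral_congr_ae ?_
    filter_upwards [(memLp_domain hk hF).coeFn_toLp] with z hz
    rw [hz]
  have hm' : ∀ {F : ℝ → ℝ} (hF : Continuous F) (ψ : ℝ → ℝ),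
      ∫ z in Ioo 0 T, (memLp_time (T := T) hF).toLp F z * ψ z =
        ∫ z in Ioo 0 T, F z * ψ z := fun hF ψ => by
    refine integral_congr_ae ?_
    filter_upwards [(memLp_time hF).coeFn_toLp] with z hz
    rw [hz]
  have hsum : ∀ φ : ℝ × ℝ → ℝ, ∫ z in domain k T,
      (-((memLp_domain hk (contDiff_dt hp.smooth).continuous).toLp (dt p) z * dt φ z) +
        (memLp_domain hk (contDiff_dx hp.smooth).continuous).toLp (dx p) z * dx φ z) =
      ∫ z in domain k T, (-(dt p z * dt φ z) + dx p z * dx φ z) := fun φ => by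
    refine integral_congr_ae ?_
    filter_upwards [(memLp_domain hk (contDiff_dt hp.smooth).continuous).coeFn_toLp,
      (memLp_domain hk (contDiff_dx hp.smooth).continuous).coeFn_toLp] with z hz hz'
    rw [hz, hz']
  refine ⟨fun φ hφ hc h0 => ⟨?_, ?_⟩, fun φ hφ hc h0 hl => ?_, fun φ hφ hc hs => ?_⟩
  · rw [hm hp.smooth.continuous, hm (contDiff_dx hp.smooth).continuous]
    exact hp.integral_mul_dx hk hT hφ
  · rw [hm hp.smooth.continuous, hm (contDiff_dt hp.smooth).continuous]
    exact hp.integral_mul_dt hk hT hφ h0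
  · rw [hsum, hm hg.continuous, hp.green hk hT hφ h0 fun t ht => (hl t ht).2]
    simp only [hw]
    have hz : ∫ t in Ioo 0 T, dx p (0, t) * φ (0, t) = 0 :=
      setIntegral_eq_zero_of_forall_eq_zero fun t ht => by
        rw [(hl t ⟨ht.1.le, ht.2.le⟩).1, mul_zero]
    rw [hz, sub_zero]
  · rw [hsum, hm hg.continuous, hm' (continuous_boundary (contDiff_dx hp.smooth)), hp.green hk hT hφ]
    · simp only [hw]
    · exact fun x _ => image_eq_zero_of_notMem_tsupport fun hz => lt_irrefl _ (hs hz).1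
    · exact fun x _ => image_eq_zero_of_notMem_tsupport fun hz => lt_irrefl _ (hs hz).2.2

theorem exists_adjointGraph_smooth {k T : ℝ} (hk : 0 < k) (hk1 : k < 1) (hT : 0 < T) :
    ∃ C : ℝ, ∀ f ∈ testFunctions k T hk, ∃ y, (f, y) ∈ adjointGraph k T hk ∧ ‖y‖ ≤ C * ‖f‖ := by
  set M := Real.exp (5 / (1 - k) * T) * (1 + k * T) with hM
  have hM0 : 0 ≤ M := by positivity
  -- The three summands bound the gradient, the trace (energy term with factor k/2) and the function
  -- itself (Poincaré).
  set N := M * (1 + 2 / k + 4 * (1 + k * T) ^ 2) with hN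
  have hN0 : 0 ≤ N := by positivity
  refine ⟨√N, ?_⟩
  rintro _ ⟨g, hg, hgc, hgs, rfl⟩
  obtain ⟨p, hps, hw, h0, h1, hfin⟩ := exists_smooth_backward hk hk1 hT hg hgc hgs
  have hp : IsSmoothBackward k T p := ⟨hps, fun t _ => h0 t, fun t ht => h1 t ht.1, hfin⟩
  refine ⟨_, hp.mem_adjointGraph hk hT hg hw, ?_⟩
  have en := hp.energy_le hk hk1 hT
  have po := hp.integral_sq_le hk hT
  simp only [hw] at en
  rw [integral_domain_add (F := fun z => dx p z ^ 2) (G := fun z => dt p z ^ 2) hk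
    ((contDiff_dx hps).continuous.pow 2) ((contDiff_dt hps).continuous.pow 2),
    ← norm_toLp_sq (memLp_domain hk (contDiff_dx hps).continuous),
    ← norm_toLp_sq (memLp_domain hk (contDiff_dt hps).continuous),
    ← norm_toLp_sq (memLp_domain hk hg.continuous),
    ← norm_toLp_sq (memLp_time (continuous_boundary (contDiff_dx hps)))] at en
  rw [← norm_toLp_sq (memLp_domain hk (contDiff_dx hps).continuous),
    ← norm_toLp_sq (memLp_domain hk hps.continuous)] at po
  set nf := ‖(memLp_domain (T := T) hk hg.continuous).toLp g‖
  set np := ‖(memLp_domain (T := T) hk hps.continuous).toLp p‖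
  set nx := ‖(memLp_domain (T := T) hk (contDiff_dx hps).continuous).toLp (dx p)‖
  set nt := ‖(memLp_domain (T := T) hk (contDiff_dt hps).continuous).toLp (dt p)‖
  set nq := ‖(memLp_time (T := T) (continuous_boundary (contDiff_dx hps))).toLp fun t => dx p (0, t)‖
  rw [← hM] at en
  have hq0 : 0 ≤ k / 2 * nq ^ 2 := by positivity
  have bx : nx ^ 2 ≤ M * nf ^ 2 := by linarith [sq_nonneg nt]
  have bt : nt ^ 2 ≤ M * nf ^ 2 := by linarith [sq_nonneg nx]
  have bq : nq ^ 2 ≤ 2 / k * (M * nf ^ 2) := by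
    rw [div_mul_eq_mul_div, le_div_iff₀ hk]
    linarith [sq_nonneg nt, sq_nonneg nx]
  have bp : np ^ 2 ≤ 4 * (1 + k * T) ^ 2 * (M * nf ^ 2) :=
    po.trans (mul_le_mul_of_nonneg_left bx (by positivity))
  have hexp : N * nf ^ 2 = M * nf ^ 2 + 2 / k * (M * nf ^ 2) + 4 * (1 + k * T) ^ 2 * (M * nf ^ 2) := by
    rw [hN]
    ring
  have c1 : 0 ≤ M * nf ^ 2 := by positivity
  have c2 : 0 ≤ 2 / k * (M * nf ^ 2) := by positivity
  have c3 : 0 ≤ 4 * (1 + k * T) ^ 2 * (M * nf ^ 2) := by positivity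
  have fin : ∀ n : ℝ, n ^ 2 ≤ N * nf ^ 2 → n ≤ √N * nf := fun n hn => by
    refine le_of_sq_le_sq ?_ (by positivity)
    rw [mul_pow, Real.sq_sqrt hN0]
    exact hn
  simp only [Prod.norm_mk, max_le_iff]
  exact ⟨fin _ (by linarith), fin _ (by linarith), fin _ (by linarith), fin _ (by linarith)⟩

/-- Well-posedness of the adjoint problem in the energy space. -/
theorem exists_adjoint_operator {k T : ℝ} (hk : 0 < k) (hk1 : k < 1) (hT : 0 < T) :
    ∃ (P : L2Domain k T →L[ℝ] L2Domain k T) (A : L2Domain k T →L[ℝ] L2Time (Ioo 0 T)),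
      ∀ f p q, IsAdjointSolution k T f p q ↔ p = P f ∧ q = A f := by
  obtain ⟨C, hC⟩ := exists_adjointGraph_smooth hk hk1 hT
  obtain ⟨B, hB⟩ := exists_clm_of_closed_relation (adjointGraph k T hk) (isClosed_adjointGraph k T hk)
    (adjointGraph_unique hk hk1 hT) (testFunctions k T hk) (dense_testFunctions hk) C hC
  refine ⟨(ContinuousLinearMap.fst ℝ _ _).comp B,
    (ContinuousLinearMap.snd ℝ _ _).comp ((ContinuousLinearMap.snd ℝ _ _).comp
      ((ContinuousLinearMap.snd ℝ _ _).comp B)), fun f p q => ?_⟩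
  rw [isAdjointSolution_iff hk]
  simp only [hB]
  constructor
  · rintro ⟨px, pt, h⟩
    simp [← h]
  · rintro ⟨rfl, rfl⟩
    exact ⟨(B f).2.1, (B f).2.2.1, rfl⟩

/-! ### Quadratic minimization and extension by zero -/

section LinearQuadratic

variable {W H : Type*} [NormedAddCommGroup W] [InnerProductSpace ℝ W] [CompleteSpace W]
  [NormedAddCommGroup H] [InnerProductSpace ℝ H] [CompleteSpace H]

open ContinuousLinearMap in
/-- The linear-quadratic minimization problem in Hilbert space: the minimizer is the unique solution
of the normal equation. -/
theorem exists_unique_minimizer (L : W →L[ℝ] H) (b : H) {σ : ℝ} (hσ : 0 < σ) :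
    ∃ v₀ : W, (∀ v, adjoint L (b + L v) + σ • v = 0 ↔ v = v₀) ∧
      (∀ v, 1 / 2 * ‖b + L v₀‖ ^ 2 + σ / 2 * ‖v₀‖ ^ 2 ≤ 1 / 2 * ‖b + L v‖ ^ 2 + σ / 2 * ‖v‖ ^ 2) ∧
      ∀ v, (∀ w, 1 / 2 * ‖b + L v‖ ^ 2 + σ / 2 * ‖v‖ ^ 2 ≤
        1 / 2 * ‖b + L w‖ ^ 2 + σ / 2 * ‖w‖ ^ 2) → v = v₀ := by
  -- The term σ makes `F` coercive, hence invertible.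
  set F : W →L[ℝ] W := adjoint L ∘L L + σ • ContinuousLinearMap.id ℝ W with hF
  have hFi : ∀ v, inner ℝ (F v) v = ‖L v‖ ^ 2 + σ * ‖v‖ ^ 2 := fun v => by
    simp [hF, inner_add_left, adjoint_inner_left, real_inner_smul_left]
  have hunit : IsUnit F := by
    refine ContinuousLinearMap.isUnit_of_forall_le_norm_inner_map F (c := ⟨σ, hσ.le⟩) hσ fun v => ?_
    rw [hFi, Real.norm_of_nonneg (by positivity)]
    change ‖v‖ ^ 2 * σ ≤ _
    nlinarith [sq_nonneg ‖L v‖]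
  have hinj : ∀ v, F v = 0 → v = 0 := fun v hv => by
    have := hFi v
    rw [hv, inner_zero_left] at this
    have h2 : σ * ‖v‖ ^ 2 ≤ 0 := by nlinarith [sq_nonneg ‖L v‖]
    have h3 : ‖v‖ ^ 2 ≤ 0 := nonpos_of_mul_nonpos_right h2 hσ
    exact norm_eq_zero.1 (by nlinarith [norm_nonneg v])
  obtain ⟨v₀, hv₀⟩ : ∃ v₀, F v₀ = - adjoint L b := by
    obtain ⟨u, hu⟩ := hunit
    refine ⟨(↑u⁻¹ : W →L[ℝ] W) (-adjoint L b), ?_⟩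
    rw [← hu]
    exact DFunLike.congr_fun u.mul_inv _
  have hnorm : ∀ v, adjoint L (b + L v) + σ • v = adjoint L b + F v := fun v => by
    simp [hF, add_assoc]
  -- Expanding about `v₀`, the cross term is the normal equation and drops out. The remainder is
  -- positive unless `v = v₀`, which gives minimality and uniqueness at once.
  have hexp : ∀ v, 1 / 2 * ‖b + L v‖ ^ 2 + σ / 2 * ‖v‖ ^ 2 =
      (1 / 2 * ‖b + L v₀‖ ^ 2 + σ / 2 * ‖v₀‖ ^ 2) +
        (1 / 2 * ‖L (v - v₀)‖ ^ 2 + σ / 2 * ‖v - v₀‖ ^ 2) := by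
    intro v
    obtain ⟨h, rfl⟩ : ∃ h, v = v₀ + h := ⟨v - v₀, by simp⟩
    have h1 : inner ℝ (adjoint L (b + L v₀) + σ • v₀) h = 0 := by
      rw [hnorm, hv₀, add_neg_cancel, inner_zero_left]
    rw [inner_add_left, adjoint_inner_left, real_inner_smul_left] at h1
    rw [map_add, ← add_assoc, norm_add_sq_real, norm_add_sq_real v₀, add_sub_cancel_left]
    linarith
  refine ⟨v₀, fun v => ⟨fun h => ?_, fun h => ?_⟩, fun v => ?_, fun v h => ?_⟩
  · refine sub_eq_zero.1 (hinj _ ?_)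
    rw [hnorm] at h
    rw [map_sub, hv₀, sub_neg_eq_add, add_comm, h]
  · rw [h, hnorm, hv₀, add_neg_cancel]
  · rw [hexp v]
    have : 0 ≤ 1 / 2 * ‖L (v - v₀)‖ ^ 2 + σ / 2 * ‖v - v₀‖ ^ 2 := by positivity
    linarith
  · have h1 := h v₀
    rw [hexp v] at h1
    have h2 : σ / 2 * ‖v - v₀‖ ^ 2 ≤ 0 := by nlinarith [sq_nonneg ‖L (v - v₀)‖]
    have h3 : ‖v - v₀‖ ^ 2 ≤ 0 := nonpos_of_mul_nonpos_right h2 (by positivity)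
    exact sub_eq_zero.1 (norm_eq_zero.1 (by nlinarith [norm_nonneg (v - v₀)]))

end LinearQuadratic

theorem memLp_indicator {S I : Set ℝ} (hS : MeasurableSet S) (hSI : S ⊆ I) (w : L2Time S) :
    MemLp (S.indicator w) 2 (volume.restrict I) := by
  rw [memLp_indicator_iff_restrict hS, Measure.restrict_restrict hS, inter_eq_self_of_subset_left hSI]
  exact Lp.memLp w

theorem integral_mul_indicator {S I : Set ℝ} (hS : MeasurableSet S) (hSI : S ⊆ I) (g w : ℝ → ℝ) :
    ∫ t in I, g t * S.indicator w t = ∫ t in S, g t * w t := by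
  have : (fun t => g t * S.indicator w t) = S.indicator fun t => g t * w t := by
    funext t
    by_cases ht : t ∈ S <;> simp [ht]
  rw [this, integral_indicator hS, Measure.restrict_restrict hS, inter_eq_self_of_subset_left hSI]

theorem indicator_ae_eq {S I : Set ℝ} (hS : MeasurableSet S) {f g : ℝ → ℝ}
    (h : f =ᵐ[volume.restrict S] g) : S.indicator f =ᵐ[volume.restrict I] S.indicator g := by
  refine ae_restrict_of_ae ?_
  filter_upwards [(ae_restrict_iff' hS).1 h] with t ht
  by_cases htS : t ∈ S <;> simp [htS, ht]

/-- Extension by zero. -/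
theorem exists_zeroExtension {S I : Set ℝ} (hS : MeasurableSet S) (hSI : S ⊆ I) :
    ∃ E : L2Time S →L[ℝ] L2Time I, (∀ w, E w =ᵐ[volume.restrict I] S.indicator w) ∧
      ∀ q, ContinuousLinearMap.adjoint E q =ᵐ[volume.restrict S] q := by
  have hSle : volume.restrict S ≤ volume.restrict I := Measure.restrict_mono_set _ hSI
  let E₀ : L2Time S →ₗ[ℝ] L2Time I :=
    { toFun := fun w => (memLp_indicator hS hSI w).toLp _
      map_add' := fun w w' => by
        rw [← MemLp.toLp_add]
        refine MemLp.toLp_congr _ _ ((indicator_ae_eq hS (Lp.coeFn_add w w')).trans ?_)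
        rw [indicator_add']
      map_smul' := fun c w => by
        rw [RingHom.id_apply, ← MemLp.toLp_const_smul]
        refine MemLp.toLp_congr _ _ ((indicator_ae_eq hS (Lp.coeFn_smul c w)).trans ?_)
        exact Filter.EventuallyEq.of_eq (indicator_const_smul S c w) }
  have hE₀ : ∀ w, E₀ w =ᵐ[volume.restrict I] S.indicator w := fun w =>
    (memLp_indicator hS hSI w).coeFn_toLp
  have hbound : ∀ w, ‖E₀ w‖ ≤ 1 * ‖w‖ := fun w => by
    rw [one_mul]
    refine le_of_sq_le_sq (le_of_eq ?_) (norm_nonneg _)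
    change ‖(memLp_indicator hS hSI w).toLp _‖ ^ 2 = _
    rw [norm_toLp_sq (memLp_indicator hS hSI w), norm_sq_eq_integral]
    have := integral_mul_indicator hS hSI (S.indicator w) w
    simp only [sq]
    rw [this]
    refine setIntegral_congr_fun hS fun t ht => ?_
    simp only [indicator_of_mem ht]
  refine ⟨E₀.mkContinuous 1 hbound, hE₀, fun q => ?_⟩
  have hq : MemLp q 2 (volume.restrict S) := (Lp.memLp q).mono_measure hSle
  -- The adjoint of extension by zero is restriction.
  have : ContinuousLinearMap.adjoint (E₀.mkContinuous 1 hbound) q = hq.toLp q := by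
    refine ext_inner_right ℝ fun w => ?_
    rw [ContinuousLinearMap.adjoint_inner_left, inner_eq_integral_mul, inner_eq_integral_mul]
    calc ∫ t in I, q t * E₀ w t = ∫ t in I, q t * S.indicator w t := by
          refine integral_congr_ae ?_
          filter_upwards [hE₀ w] with t ht
          rw [ht]
      _ = ∫ t in S, q t * w t := integral_mul_indicator hS hSI q w
      _ = _ := by
          refine integral_congr_ae ?_
          filter_upwards [hq.coeFn_toLp] with t ht
          rw [ht]
  rw [this]
  exact hq.coeFn_toLp

end MovingWave

end

/-! ### Nash equilibrium and optimality system -/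

theorem theorem3p1 (k T σ : ℝ) (hk0 : 0 < k) (hk1 : k < 1) (hT : 0 < T) (hσ : 0 < σ)
    (S₁ S₂ : Set ℝ) (hS₁ : MeasurableSet S₁) (hS₂ : MeasurableSet S₂)
    (hS : S₁ ∪ S₂ = Set.Ioo 0 T)
    (ud : MovingWave.L2Domain k T) (w₁ : MovingWave.L2Time S₁) :
    -- every follower control produces exactly one state, so the cost is well defined
    (∀ w₂ : MovingWave.L2Time S₂, ∃! u, MovingWave.IsState k T S₁ S₂ w₁ w₂ u) ∧
    ∃ w₂ : MovingWave.L2Time S₂,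
      -- `w₂` is the unique Nash equilibrium
      MovingWave.IsNashEquilibrium k T σ S₁ S₂ ud w₁ w₂ ∧
      (∀ v, MovingWave.IsNashEquilibrium k T σ S₁ S₂ ud w₁ v → v = w₂) ∧
      -- the optimality system has exactly one solution `{u, p}`, with `q = p_x(0, ·)`
      ∃ (u p : MovingWave.L2Domain k T) (q : MovingWave.L2Time (Set.Ioo 0 T)),
        MovingWave.IsOptimalitySystem k T σ S₁ S₂ ud w₁ u p q ∧
        (∀ u' p' q', MovingWave.IsOptimalitySystem k T σ S₁ S₂ ud w₁ u' p' q' →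
          u' = u ∧ p' = p ∧ q' = q) ∧
        -- the formula for the follower
        ∀ᵐ t ∂(MeasureTheory.volume.restrict S₂), w₂ t = -(1 / σ) * q t := by
  open MovingWave ContinuousLinearMap in
  obtain ⟨P, A, hPA⟩ := exists_adjoint_operator hk0 hk1 hT
  have hI₁ : S₁ ⊆ Ioo 0 T := hS ▸ subset_union_left
  have hI₂ : S₂ ⊆ Ioo 0 T := hS ▸ subset_union_right
  obtain ⟨E₁, hE₁, -⟩ := exists_zeroExtension hS₁ hI₁
  obtain ⟨E₂, hE₂, hR₂⟩ := exists_zeroExtension hS₂ hI₂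
  -- Every source has exactly one adjoint solution, so the transposition identity ranges over all
  -- `f` and pins down `u` as A* of the control.
  have htr : ∀ (w : ℝ → ℝ) (v : L2Time (Ioo 0 T)), v =ᵐ[volume.restrict (Ioo 0 T)] w →
      ∀ u, IsTranspositionSolution k T w u ↔ u = adjoint A v := by
    intro w v hvw u
    have hw : ∀ g : L2Time (Ioo 0 T), ∫ t in Ioo 0 T, w t * g t = inner ℝ v g := fun g => by
      rw [inner_eq_integral_mul]
      refine integral_congr_ae ?_
      filter_upwards [hvw] with t ht
      rw [ht]
    have h1 : IsTranspositionSolution k T w u ↔ ∀ f, inner ℝ u f = inner ℝ (adjoint A v) f := by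
      simp only [IsTranspositionSolution, hPA, hw, adjoint_inner_left, inner_eq_integral_mul u]
      exact ⟨fun h f => h f _ _ ⟨rfl, rfl⟩, fun h f _ _ ⟨_, hq⟩ => hq ▸ h f⟩
    rw [h1]
    exact ⟨fun h => ext_inner_right ℝ h, fun h f => by rw [h]⟩
  have hctrl : ∀ (w : ℝ → ℝ) (v : L2Time S₂), v =ᵐ[volume.restrict S₂] w →
      ⇑(E₁ w₁ + E₂ v) =ᵐ[volume.restrict (Ioo 0 T)] MovingWave.control S₁ S₂ w₁ w := by
    intro w v hvw
    filter_upwards [Lp.coeFn_add (E₁ w₁) (E₂ v), hE₁ w₁, hE₂ v, indicator_ae_eq hS₂ hvw] with t h1 h2 h3 h4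
    rw [h1, Pi.add_apply, h2, h3, h4, MovingWave.control]
  have hstate : ∀ v u, IsState k T S₁ S₂ w₁ v u ↔ u = adjoint A (E₁ w₁ + E₂ v) := fun v =>
    htr _ _ (hctrl v v (ae_eq_refl _))
  set b : L2Domain k T := adjoint A (E₁ w₁) - ud with hb
  set L : L2Time S₂ →L[ℝ] L2Domain k T := adjoint A ∘L E₂ with hL
  have hbL : ∀ v, adjoint A (E₁ w₁ + E₂ v) - ud = b + L v := fun v => by
    rw [hb, hL, map_add, comp_apply]
    abel
  have hcost : ∀ v, followerCost k T σ S₁ S₂ ud w₁ v =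
      1 / 2 * ‖b + L v‖ ^ 2 + σ / 2 * ‖v‖ ^ 2 := fun v => by
    have h1 : state k T S₁ S₂ w₁ v = adjoint A (E₁ w₁ + E₂ v) :=
      (hstate v _).1 (Classical.epsilon_spec (p := IsState k T S₁ S₂ w₁ v) ⟨_, (hstate v _).2 rfl⟩)
    rw [followerCost, ← norm_sq_eq_integral, ← hbL, ← h1, norm_sq_eq_integral (state k T S₁ S₂ w₁ v - ud)]
    congr 2
    refine integral_congr_ae ?_
    filter_upwards [Lp.coeFn_sub (state k T S₁ S₂ w₁ v) ud] with z hz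
    rw [hz, Pi.sub_apply]
  obtain ⟨v₀, hnormal, hmin, huniq⟩ := exists_unique_minimizer L b hσ
  have hadj : ∀ v, adjoint L (b + L v) = adjoint E₂ (A (adjoint A (E₁ w₁ + E₂ v) - ud)) := fun v => by
    rw [hbL, hL, adjoint_comp, adjoint_adjoint, comp_apply]
  have hfollow : ∀ (q : L2Time (Ioo 0 T)), ⇑(-(1 / σ) • adjoint E₂ q) =ᵐ[volume.restrict S₂]
      fun t => -(1 / σ) * q t := fun q => by
    filter_upwards [Lp.coeFn_smul (-(1 / σ)) (adjoint E₂ q), hR₂ q] with t h1 h2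
    rw [h1, Pi.smul_apply, h2, smul_eq_mul]
  have hsolve : ∀ (v x : L2Time S₂), x + σ • v = 0 ↔ v = -(1 / σ) • x := fun v x => by
    constructor
    · intro h
      rw [eq_neg_of_add_eq_zero_left h, smul_neg, neg_smul, neg_neg, smul_smul,
        one_div_mul_cancel hσ.ne', one_smul]
    · rintro rfl
      rw [smul_smul, mul_neg, mul_one_div_cancel hσ.ne', neg_one_smul, add_neg_cancel]
  -- The control appearing in the system, -(1/σ) E₂* A(u - u_d), satisfies the normal equation
  -- precisely when u is the state it generates, so it must be `v₀`.
  have hopt : ∀ u p q, IsOptimalitySystem k T σ S₁ S₂ ud w₁ u p q ↔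
      (p = P (u - ud) ∧ q = A (u - ud)) ∧ u = adjoint A (E₁ w₁ + E₂ v₀) := by
    intro u p q
    rw [IsOptimalitySystem, hPA, htr _ _ (hctrl _ _ (hfollow q))]
    refine and_congr_right fun hpq => ?_
    rw [hpq.2]
    constructor
    · intro hu
      have h1 : -(1 / σ) • adjoint E₂ (A (u - ud)) = v₀ := by
        rw [← hnormal, hadj, ← hu, hsolve]
      rw [h1] at hu
      exact hu
    · intro hu
      have h1 := (hnormal v₀).2 rfl
      rw [hadj, ← hu, hsolve] at h1
      rw [← h1]
      exact hu
  refine ⟨fun v => ⟨_, (hstate v _).2 rfl, fun u hu => (hstate v u).1 hu⟩, v₀, fun v => ?_,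
    fun v hv => huniq v fun w => ?_, adjoint A (E₁ w₁ + E₂ v₀), _, _,
    (hopt _ _ _).2 ⟨⟨rfl, rfl⟩, rfl⟩, fun u' p' q' h => ?_, ?_⟩
  · rw [hcost, hcost]
    exact hmin v
  · rw [← hcost, ← hcost]
    exact hv w
  · obtain ⟨⟨rfl, rfl⟩, rfl⟩ := (hopt _ _ _).1 h
    exact ⟨rfl, rfl, rfl⟩
  · have h1 := (hnormal v₀).2 rfl
    rw [hadj, hsolve] at h1
    have h2 := hfollow (A (adjoint A (E₁ w₁ + E₂ v₀) - ud))
    rw [← h1] at h2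
    exact h2
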